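/- Let $\gamma_n$ be the standard Gaussian measure on $\mathbb{R}^n$, $\gamma_1(z)=e^{-z^2/2}/\sqrt{2\pi}$, $\Phi(t)=\int_{-\infty}^t\gamma_1(z)\,dz$, $H_3(z)=z^3-3z$, and $\langle f,g\rangle=\int fg\,d\gamma_n$. Let $P_k$ be the orthogonal projection of $L_2(\gamma_n)$ onto the level-$k$ Hermite polynomials; in particular $P_1f(x)=\int\langle x,y\rangle f(y)\,d\gamma_n(y)$. Put $R_\lambda=P_1-\lambda I$, and let $\mathcal{M}_{\lambda,n}$ be the set of measurable $g\colon\mathbb{R}^n\to[-1,1]$ that maximize $\|R_\lambda g\|_{L_1(\gamma_n)}$ among all such functions. For $\eta>0$ let $\lambda=\lambda(\eta)=\sqrt{2/\pi}\,\eta e^{-\eta^2/2}$, $\alpha=\lambda/\eta$, $$B=2\int_\eta^\infty H_3(z)\gamma_1(z)\,dz,\qquad A_{\max}=\eta^2(\gamma_1(0)-\gamma_1(\eta)),\qquad \kappa_Q=\frac{B^2-A_{\max}^2}{6},$$ and, for $Z\sim N(0,1)$, $p=\mathbb{P}(|Z|<\eta)$, $s_1=\mathbb{E}[|Z|1_{\{|Z|<\eta\}}]$,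 $t_2=\mathbb{E}[Z^21_{\{|Z|<\eta\}}]$. **(A)** Let $0<\eta<1/2$. Then $\alpha=2\gamma_1(\eta)$, $B=-2(1-\eta^2)\gamma_1(\eta)$, $p=2\Phi(\eta)-1$, $s_1=2(\gamma_1(0)-\gamma_1(\eta))$ and $t_2=p-2\eta\gamma_1(\eta)$. Moreover let $n\ge1$, let $g\in\mathcal{M}_{\lambda,n}$ take values in $\{\pm1\}$, and put $f=\mathrm{sign}(R_\lambda g)$, $m=\int x\,g(x)\,d\gamma_n(x)$. Then $\|m\|_2=\|P_1g\|_2=\alpha>0$, $f\in\{\pm1\}$ almost everywhere, and with $u=m/\|m\|_2$, $X\sim\gamma_n$, $Z=\langle u,X\rangle$, $Y=X-Zu$ we have $P_1g(X)=\alpha Z$. Let $P_{3,0}$, $P_{1,2}$, $P_{2,1}$, $P_{0,3}$ and $P_\perp$ be the orthogonal projections onto, respectively, the line spanned by $H_3(Z)$, the spaces $\mathcal{H}_j(Z)\otimes\mathcal{H}_k(Y)$ of Hermite polynomials of degree $j$ in $Z$ and $k$ in $Y$ for $(j,k)=(1,2),(2,1),(0,3)$, and the sum of these three spaces. Then $P_3g=P_{3,0}g+P_\perp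 g$, $P_\perp g=P_{1,2}g+P_{2,1}g+P_{0,3}g$, $$\langle f,P_3g\rangle=\tfrac16\,\mathbb{E}[g(X)H_3(Z)]\,\mathbb{E}[f(X)H_3(Z)]-\|P_\perp g\|_2^2,\qquad \tfrac16\,\mathbb{E}[g(X)H_3(Z)]\,\mathbb{E}[f(X)H_3(Z)]\ge\kappa_Q,$$ $$\|P_\perp g\|_2^2\le p^2+s_1^2+\tfrac12t_2^2,\qquad\text{and hence}\qquad \langle f,P_3g\rangle\ge\kappa_Q-\left(p^2+s_1^2+\tfrac12t_2^2\right).$$ **(B)** There is exactly one $\eta_*\in(0,1)$ that maximizes the Davie–Reeds quantity $\dfrac{1-\lambda(\eta)}{(\lambda(\eta)/\eta)^2+\lambda(\eta)(1-4\Phi(-\eta))}$ over $\eta\in(0,1)$. It satisfies $\eta_*<1/2$, and $\lambda_*=\lambda(\eta_*)$ satisfies $|\lambda_*-0.197479091|\le10^{-11}$. At $\eta=\eta_*$ one has $\kappa_Q\ge0.0868120048$, $p^2+s_1^2+\frac12t_2^2\le0.0414080847$ and $\left|\kappa_Q-(p^2+s_1^2+\frac12t_2^2)-0.0454039202\right|\le10^{-10}$.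 Consequently, for every $n\ge1$ and every $\{\pm1\}$-valued $g\in\mathcal{M}_{\lambda_*,n}$, $$\langle\mathrm{sign}(R_{\lambda_*}g),P_3g\rangle\ \ge\ \kappa_Q-\left(p^2+s_1^2+\tfrac12t_2^2\right),\qquad \langle\mathrm{sign}(R_{\lambda_*}g),P_3g\rangle\ \ge\ 0.0868120048-0.0414080847>0.$$ -/

import Mathlib

open MeasureTheory ProbabilityTheory

namespace ReedsOperator

noncomputable section

/-- `ℝⁿ` with its Euclidean norm. -/
abbrev E (n : ℕ) : Type := EuclideanSpace ℝ (Fin n)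

/-- The standard Gaussian measure `γ_n` on `ℝⁿ`. -/
abbrev gam (n : ℕ) : Measure (E n) := stdGaussian (E n)

/-- The Gaussian inner product `⟨f, g⟩ = ∫ f g dγ_n`. -/
def pairing {n : ℕ} (f g : E n → ℝ) : ℝ := ∫ x, f x * g x ∂gam n

/-- The first moment `m = 𝔼[g(X) X]`. -/
def firstMoment {n : ℕ} (g : E n → ℝ) : E n := ∫ x, g x • x ∂gam n

/-- The direction `u = m / ‖m‖` of the first moment. -/
def dir {n : ℕ} (g : E n → ℝ) : E n := ‖firstMoment g‖⁻¹ • firstMoment g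

/-- `P₁ f (x) = ∫ ⟨x, y⟩ f(y) dγ_n(y)`. -/
def P1 {n : ℕ} (f : E n → ℝ) (x : E n) : ℝ := ∫ y, inner ℝ x y * f y ∂gam n

/-- `R_lam = P₁ - lam I`. -/
def R {n : ℕ} (lam : ℝ) (f : E n → ℝ) (x : E n) : ℝ := P1 f x - lam * f x

/-- `sign (R_lam g)`. -/
def signR {n : ℕ} (lam : ℝ) (g : E n → ℝ) (x : E n) : ℝ := Real.sign (R lam g x)

/-- The measurable functions `ℝⁿ → [-1, 1]`. -/
def unitFunctions (n : ℕ) : Set (E n → ℝ) := {f | Measurable f ∧ ∀ x, |f x| ≤ 1}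

/-- `g : ℝⁿ → [-1, 1]` is measurable and maximizes `‖R_lam g‖₁` among all such functions. -/
def IsMaximizer {n : ℕ} (lam : ℝ) (g : E n → ℝ) : Prop :=
  g ∈ unitFunctions n ∧ IsMaxOn (fun f => ∫ x, |R lam f x| ∂gam n) (unitFunctions n) g

/-- The value at `z` of the `k`-th (probabilists') Hermite polynomial. -/
def H (k : ℕ) (z : ℝ) : ℝ := Polynomial.aeval z (Polynomial.hermite k)

theorem H_one (z : ℝ) : H 1 z = z := by
  simp [H]

theorem H_two (z : ℝ) : H 2 z = z ^ 2 - 1 := by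
  simp [H, Polynomial.hermite_succ]
  ring

theorem H_three (z : ℝ) : H 3 z = z ^ 3 - 3 * z := by
  simp [H, Polynomial.hermite_succ]
  ring

/-- The `k`-th Gaussian chaos: the span in `L²(γ_n)` of the Hermite functions
`∏ i, H_{a i}(x_i)` of total degree `∑ i, a i = k`. -/
def chaos (n k : ℕ) : Submodule ℝ (Lp ℝ 2 (gam n)) :=
  Submodule.span ℝ {φ | ∃ a : Fin n → ℕ, ∑ i, a i = k ∧ φ =ᵐ[gam n] fun x => ∏ i, H (a i) (x i)}

/-- The block `𝓗_j(Z) ⊗ 𝓗_k(Y)`, for `k ≥ 1`, where `Z = ⟨u, X⟩` and `Y` is the component of `X`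
orthogonal to `u`; the chaos `𝓗_k(Y)` is spanned by the `H_k(⟨v, X⟩)` with `v ⊥ u`, `‖v‖ = 1`. -/
def block {n : ℕ} (u : E n) (j k : ℕ) : Submodule ℝ (Lp ℝ 2 (gam n)) :=
  Submodule.span ℝ {φ | ∃ v : E n, ‖v‖ = 1 ∧ inner ℝ u v = 0 ∧
    φ =ᵐ[gam n] fun x => H j (inner ℝ u x) * H k (inner ℝ v x)}

/-- The transverse part of the third chaos. -/
def transverse {n : ℕ} (u : E n) : Submodule ℝ (Lp ℝ 2 (gam n)) :=
  block u 1 2 ⊔ block u 2 1 ⊔ block u 0 3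

/-- The zonal part of the third chaos, the line spanned by `H₃(Z)`. -/
def zonal {n : ℕ} (u : E n) : Submodule ℝ (Lp ℝ 2 (gam n)) :=
  Submodule.span ℝ {φ | φ =ᵐ[gam n] fun x => H 3 (inner ℝ u x)}

open Classical in
/-- A representative of the orthogonal projection in `L²(γ_n)` of the function `f` onto (the
closure of) `K`. All subspaces `K` used here are finite-dimensional, hence closed. -/
def proj {n : ℕ} (K : Submodule ℝ (Lp ℝ 2 (gam n))) (f : E n → ℝ) : E n → ℝ :=
  if hf : MemLp f 2 (gam n) then ⇑(K.topologicalClosure.starProjection (hf.toLp f)) else 0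

/-- `P₃`, the projection onto the third chaos. -/
def P3 {n : ℕ} (f : E n → ℝ) : E n → ℝ := proj (chaos n 3) f

/-- The density of `N(0,1)`. -/
def gd (z : ℝ) : ℝ := Real.exp (-z ^ 2 / 2) / Real.sqrt (2 * Real.pi)

/-- The distribution function of `N(0,1)`. -/
def Phi (t : ℝ) : ℝ := ∫ z in Set.Iic t, gd z

/-- `lam = √(2/π) η e^{-η²/2}`. -/
def lamOf (η : ℝ) : ℝ := Real.sqrt (2 / Real.pi) * η * Real.exp (-η ^ 2 / 2)

/-- `α = lam / η`. -/
def alphaOf (η : ℝ) : ℝ := lamOf η / η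

/-- The Davie-Reeds lower bound for the Grothendieck constant that comes from `R_lam`,
`lam = lamOf η`. -/
def davieReeds (η : ℝ) : ℝ :=
  (1 - lamOf η) / ((lamOf η / η) ^ 2 + lamOf η * (1 - 4 * Phi (-η)))

/-- `η ∈ (0,1)` is the parameter `η_*` of the optimal value `lam_*` of `lam`. -/
def IsReedsPoint (η : ℝ) : Prop :=
  η ∈ Set.Ioo (0 : ℝ) 1 ∧ IsMaxOn davieReeds (Set.Ioo 0 1) η

def B (η : ℝ) : ℝ := 2 * ∫ z in Set.Ioi η, (z ^ 3 - 3 * z) * gd z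

def Amax (η : ℝ) : ℝ := η ^ 2 * (gd 0 - gd η)

def kappaQ (η : ℝ) : ℝ := (B η ^ 2 - Amax η ^ 2) / 6

/-- `p = ℙ(|Z| < η)` for `Z ∼ N(0,1)`. -/
def p (η : ℝ) : ℝ := (gaussianReal 0 1).real {z | |z| < η}

/-- `s₁ = 𝔼[|Z| 1_{|Z| < η}]`. -/
def s₁ (η : ℝ) : ℝ := ∫ z in {z | |z| < η}, |z| ∂gaussianReal 0 1

/-- `t₂ = 𝔼[Z² 1_{|Z| < η}]`. -/
def t₂ (η : ℝ) : ℝ := ∫ z in {z | |z| < η}, z ^ 2 ∂gaussianReal 0 1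

/-- `p² + s₁² + t₂²/2`. -/
def transverseBound (η : ℝ) : ℝ := p η ^ 2 + s₁ η ^ 2 + t₂ η ^ 2 / 2

end

end ReedsOperator

open ReedsOperator

namespace ReedsOperator

noncomputable section

open Filter Topology

/-! Write γ for the one-dimensional density, m for the first moment of g, r = ‖m‖ and w = ⟨m, x⟩ =
P₁g(x). Pointwise, |w - λg| + wg ≤ λ + 2 max(|w| - λ, 0) (`abs_sub_add_mul_le`). Since E[wg] = r²,
integration bounds ‖R_λ g‖₁ by a function of r alone, `valueBound`. In the variable h = λ/r, with λ
= 2ηγ(η), its derivative has the sign of ηγ(η) - hγ(h). For η < 1/2 the critical point h = η is the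
strict global maximum, that is r = α (`valueBound_lt`). A function of one coordinate attains this
value, so a maximizer has r = α and equality almost everywhere in the pointwise bound, which forces
g = sign Z where |Z| > η (`maximizer_structure`).

Split a ±1-valued maximizer as g = s + o, with s supported in the slab |Z| < η and o a function of
Z. In the slab λ dominates αZ, outside it αZ dominates λ; hence f = sign(R_λ g) = o - s = 2o - g.
The third chaos splits orthogonally by the degree in Z (`chaos_three_eq_sup`). On H₃(Z) the moments
of g and f are B + A and B - A, where A = E[s H₃(Z)], so their product is B² - A²; E[sZ] = 0 allows
H₃ to be modified by a multiple of Z and gives |A| ≤ A_max. On the transverse part o disappears, so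
f contributes exactly -‖P_⊥ g‖². The projection of g to a block has the form H_j(Z) q(Y), and
independence of Z and Y with E|q| ≤ (E q²)^{1/2} bounds its norm by a slab moment
(`MaxStructure.norm_projLp_block_le`).

For the numbers, the derivative of the Davie–Reeds quantity is a negative multiple of the increasing
function 4γ² + 4Φ - 3. Taylor polynomials enclose its root in an interval of length 2·10⁻¹², and
monotone estimates on that interval give every constant. -/

/-! ### The one-dimensional Gaussian: density, distribution function, truncated moments -/

theorem gd_eq : gd = gaussianPDFReal 0 1 := by
  funext z
  simp only [gd, gaussianPDFReal, NNReal.coe_one, mul_one, sub_zero]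
  field_simp

theorem gd_pos (z : ℝ) : 0 < gd z := by unfold gd; positivity

theorem gd_neg (z : ℝ) : gd (-z) = gd z := by simp [gd]

theorem continuous_gd : Continuous gd := by unfold gd; fun_prop

theorem hasDerivAt_gd (z : ℝ) : HasDerivAt gd (-z * gd z) z := by
  unfold gd
  have h : HasDerivAt (fun z : ℝ => -z ^ 2 / 2) (-z) z := by
    have := ((hasDerivAt_pow 2 z).neg).div_const 2
    refine this.congr_deriv ?_
    norm_num; ring
  refine (h.exp.div_const _).congr_deriv ?_
  ring

theorem integrable_gd : Integrable gd := by
  rw [gd_eq]; exact integrable_gaussianPDFReal 0 1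

theorem integral_gd : ∫ z, gd z = 1 := by
  rw [gd_eq]; exact integral_gaussianPDFReal_eq_one 0 one_ne_zero

theorem gaussian_eq_withDensity :
    gaussianReal 0 1 = volume.withDensity (fun z => ENNReal.ofReal (gd z)) := by
  rw [gaussianReal_of_var_ne_zero 0 one_ne_zero, gd_eq]; rfl

theorem measurable_gd : Measurable gd := continuous_gd.measurable

theorem integrable_gaussian_iff {f : ℝ → ℝ} :
    Integrable f (gaussianReal 0 1) ↔ Integrable (fun z => f z * gd z) := by
  rw [gaussian_eq_withDensity, integrable_withDensity_iff
    (measurable_gd.ennreal_ofReal) (by simp)]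
  simp [ENNReal.toReal_ofReal (gd_pos _).le]

theorem setIntegral_gaussian (f : ℝ → ℝ) {s : Set ℝ} (hs : MeasurableSet s) :
    ∫ z in s, f z ∂gaussianReal 0 1 = ∫ z in s, f z * gd z := by
  rw [← integral_indicator hs, ← integral_indicator hs,
    integral_gaussianReal_eq_integral_smul one_ne_zero, ← gd_eq]
  congr 1; funext z
  by_cases h : z ∈ s <;> simp [h, mul_comm]

theorem integral_gaussian' (f : ℝ → ℝ) :
    ∫ z, f z ∂gaussianReal 0 1 = ∫ z, f z * gd z := by
  simpa using setIntegral_gaussian f MeasurableSet.univ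

theorem integrable_pow_gaussian (k : ℕ) :
    Integrable (fun z : ℝ => z ^ k) (gaussianReal 0 1) := by
  have h := (memLp_id_gaussianReal (μ := 0) (v := 1) k).integrable_norm_pow'
  refine h.mono' (by fun_prop) ?_
  filter_upwards with z
  simp

theorem integrable_pow_mul_gd (k : ℕ) : Integrable (fun z : ℝ => z ^ k * gd z) :=
  integrable_gaussian_iff.1 (integrable_pow_gaussian k)

theorem integrable_id_mul_gd : Integrable (fun z : ℝ => z * gd z) := by
  simpa using integrable_pow_mul_gd 1

theorem Phi_sub_Phi (s t : ℝ) : Phi t - Phi s = ∫ z in s..t, gd z :=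
  (intervalIntegral.integral_Iic_sub_Iic integrable_gd.integrableOn integrable_gd.integrableOn)

theorem hasDerivAt_Phi (t : ℝ) : HasDerivAt Phi (gd t) t := by
  have h : Phi = fun t => (∫ z in (0 : ℝ)..t, gd z) + Phi 0 := by
    funext t; rw [← Phi_sub_Phi]; ring
  rw [h]
  exact (intervalIntegral.integral_hasDerivAt_right (integrable_gd.intervalIntegrable)
    (continuous_gd.stronglyMeasurableAtFilter _ _) continuous_gd.continuousAt).add_const _

theorem integral_Ioi_gd (t : ℝ) : ∫ z in Set.Ioi t, gd z = Phi (-t) := by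
  rw [Phi, ← integral_comp_neg_Ioi]
  simp [gd_neg]

theorem Phi_neg (t : ℝ) : Phi (-t) = 1 - Phi t := by
  have := intervalIntegral.integral_Iic_add_Ioi (b := t) (f := gd) (μ := volume)
    integrable_gd.integrableOn integrable_gd.integrableOn
  rw [integral_Ioi_gd, integral_gd] at this
  unfold Phi at *
  linarith

theorem Phi_zero : Phi 0 = 1 / 2 := by
  have := Phi_neg 0
  rw [neg_zero] at this; linarith

theorem Phi_nonneg (t : ℝ) : 0 ≤ Phi t := by
  unfold Phi; exact integral_nonneg fun z => (gd_pos z).le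

theorem tendsto_gd_atTop (k : ℕ) : Tendsto (fun z : ℝ => z ^ k * gd z) atTop (𝓝 0) := by
  have h := (Real.tendsto_pow_mul_exp_neg_atTop_nhds_zero k).div_const (Real.sqrt (2 * Real.pi))
  rw [zero_div] at h
  refine squeeze_zero' ?_ ?_ h
  · filter_upwards [eventually_ge_atTop 0] with z hz
    have := (gd_pos z).le; positivity
  · filter_upwards [eventually_ge_atTop 2] with z hz
    unfold gd
    rw [mul_div_assoc]
    gcongr
    nlinarith

theorem integral_Ioi_id_mul_gd (h : ℝ) : ∫ z in Set.Ioi h, z * gd z = gd h := by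
  have := integral_Ioi_of_hasDerivAt_of_tendsto' (a := h) (f := fun z => -gd z)
    (f' := fun z => z * gd z) (m := 0) (fun z _ => (hasDerivAt_gd z).neg.congr_deriv (by ring))
    integrable_id_mul_gd.integrableOn (by simpa using (tendsto_gd_atTop 0).neg)
  simpa using this

/-- The relation (H₂γ)' = -H₃γ provides the primitive -(z² - 1)γ(z), which vanishes at infinity. -/
theorem B_eq (η : ℝ) : B η = -2 * (1 - η ^ 2) * gd η := by
  have h1 : Integrable (fun z : ℝ => (z ^ 3 - 3 * z) * gd z) := by
    refine ((integrable_pow_mul_gd 3).sub (integrable_id_mul_gd.const_mul 3)).congr ?_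
    filter_upwards with z; simp; ring
  have := integral_Ioi_of_hasDerivAt_of_tendsto' (a := η) (f := fun z => -(z ^ 2 - 1) * gd z)
    (f' := fun z => (z ^ 3 - 3 * z) * gd z) (m := 0)
    (fun z _ => ((((hasDerivAt_pow 2 z).sub_const 1).neg).mul (hasDerivAt_gd z)).congr_deriv
      (by simp; ring))
    h1.integrableOn (by
      have := (tendsto_gd_atTop 0).sub (tendsto_gd_atTop 2)
      simp only [sub_zero] at this
      refine this.congr fun z => ?_
      ring)
  rw [B, this]; ring

theorem alphaOf_eq {η : ℝ} (h : η ≠ 0) : alphaOf η = 2 * gd η := by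
  have h1 : Real.sqrt (2 / Real.pi) = 2 / Real.sqrt (2 * Real.pi) := by
    rw [Real.sqrt_eq_iff_mul_self_eq (by positivity) (by positivity), div_mul_div_comm,
      Real.mul_self_sqrt (by positivity)]
    field_simp
  rw [alphaOf, lamOf, gd, h1]
  field_simp

theorem lamOf_eq (η : ℝ) : lamOf η = 2 * η * gd η := by
  rcases eq_or_ne η 0 with rfl | h
  · simp [lamOf]
  · have := alphaOf_eq h
    rw [alphaOf, div_eq_iff h] at this
    rw [this]; ring

theorem measurableSet_abs_lt (η : ℝ) : MeasurableSet {z : ℝ | |z| < η} :=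
  measurableSet_lt (by fun_prop) (by fun_prop)

theorem setIntegral_abs_lt {f : ℝ → ℝ} {η : ℝ} (hη : 0 < η) :
    ∫ z in {z : ℝ | |z| < η}, f z ∂gaussianReal 0 1 = ∫ z in (-η)..η, f z * gd z := by
  rw [setIntegral_gaussian f (measurableSet_abs_lt η),
    intervalIntegral.integral_of_le (by linarith), integral_Ioc_eq_integral_Ioo]
  congr 2
  ext z; simp [abs_lt]

theorem p_eq {η : ℝ} (hη : 0 < η) : p η = 2 * Phi η - 1 := by
  have h : p η = ∫ z in {z : ℝ | |z| < η}, (1 : ℝ) ∂gaussianReal 0 1 := by simp [p]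
  rw [h, setIntegral_abs_lt hη]
  simp only [one_mul]
  rw [← Phi_sub_Phi, Phi_neg]; ring

theorem s₁_eq {η : ℝ} (hη : 0 < η) : s₁ η = 2 * (gd 0 - gd η) := by
  have hc : Continuous fun z => |z| * gd z := continuous_abs.mul continuous_gd
  rw [s₁, setIntegral_abs_lt hη, ← intervalIntegral.integral_add_adjacent_intervals (b := 0)
    (hc.intervalIntegrable _ _) (hc.intervalIntegrable _ _)]
  have h2 : ∫ z in (0 : ℝ)..η, |z| * gd z = gd 0 - gd η := by
    have h : ∫ z in (0 : ℝ)..η, |z| * gd z = ∫ z in (0 : ℝ)..η, z * gd z := by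
      refine intervalIntegral.integral_congr fun z hz => ?_
      rw [Set.uIcc_of_le hη.le] at hz
      simp [abs_of_nonneg hz.1]
    rw [h, intervalIntegral.integral_eq_sub_of_hasDerivAt (f := fun z => -gd z)
      (f' := fun z => z * gd z) (fun z _ => (hasDerivAt_gd z).neg.congr_deriv (by ring))
      (Continuous.intervalIntegrable (by have := continuous_gd; fun_prop) _ _)]
    ring
  have h1 : ∫ z in (-η)..(0 : ℝ), |z| * gd z = ∫ z in (0 : ℝ)..η, |z| * gd z := by
    have := intervalIntegral.integral_comp_neg (a := -η) (b := 0) (fun z => |z| * gd z)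
    simpa [gd_neg] using this
  rw [h1, h2]; ring

theorem t₂_eq {η : ℝ} (hη : 0 < η) : t₂ η = p η - 2 * η * gd η := by
  rw [t₂, setIntegral_abs_lt hη, p_eq hη,
    intervalIntegral.integral_eq_sub_of_hasDerivAt (f := fun z => Phi z - z * gd z)
      (f' := fun z => z ^ 2 * gd z) (fun z _ => ((hasDerivAt_Phi z).sub ((hasDerivAt_id z).mul (hasDerivAt_gd z))).congr_deriv
        (by simp; ring))
      (Continuous.intervalIntegrable (by have := continuous_gd; fun_prop) _ _)]
  rw [Phi_neg, gd_neg]; ring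

theorem s₁_nonneg {η : ℝ} : 0 ≤ s₁ η :=
  integral_nonneg fun z => abs_nonneg z

theorem t₂_nonneg {η : ℝ} : 0 ≤ t₂ η :=
  integral_nonneg fun z => sq_nonneg z

theorem p_nonneg {η : ℝ} : 0 ≤ p η := measureReal_nonneg

/-! ### The upper bound as a function of the first moment, and its unique maximum -/

/-- An upper bound for `‖R_lam g‖₁` in terms of `r = ‖𝔼[g(X) X]‖`. -/
def valueBound (lam r : ℝ) : ℝ :=
  lam - r ^ 2 + 2 * ∫ z, max (r * |z| - lam) 0 ∂gaussianReal 0 1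

theorem integral_max_gaussian {r h : ℝ} (hr : 0 < r) (hh : 0 < h) :
    ∫ z, max (r * |z| - r * h) 0 ∂gaussianReal 0 1 = 2 * r * (gd h - h * Phi (-h)) := by
  rw [integral_gaussian']
  have h1 : ∀ z : ℝ, max (r * |z| - r * h) 0 * gd z =
      (fun w => max (r * w - r * h) 0 * gd w) |z| := by
    intro z
    rcases abs_choice z with h | h <;> simp [h, gd_neg]
  simp_rw [h1]
  rw [integral_comp_abs (f := fun w => max (r * w - r * h) 0 * gd w)]
  have h2 : ∫ w in Set.Ioi (0 : ℝ), max (r * w - r * h) 0 * gd w =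
      ∫ w in Set.Ioi h, (r * (w * gd w) - r * h * gd w) := by
    rw [← integral_indicator measurableSet_Ioi, ← integral_indicator measurableSet_Ioi]
    congr 1; funext w
    rcases le_or_gt w h with hw | hw
    · rw [Set.indicator_of_notMem (by simpa using hw : w ∉ Set.Ioi h)]
      rw [Set.indicator_apply_eq_zero]
      intro _
      rw [max_eq_right (by nlinarith), zero_mul]
    · rw [Set.indicator_of_mem (by simpa using hw : w ∈ Set.Ioi h),
        Set.indicator_of_mem (by simpa using hh.trans hw : w ∈ Set.Ioi 0),
        max_eq_left (by nlinarith)]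
      ring
  rw [h2, integral_sub (integrable_id_mul_gd.const_mul _).integrableOn
    (integrable_gd.const_mul _).integrableOn, integral_const_mul, integral_const_mul,
    integral_Ioi_id_mul_gd, integral_Ioi_gd]
  ring

theorem valueBound_eq {r h : ℝ} (hr : 0 < r) (hh : 0 < h) :
    valueBound (r * h) r = r * h - r ^ 2 + 4 * r * (gd h - h * Phi (-h)) := by
  rw [valueBound, integral_max_gaussian hr hh]; ring

theorem alphaOf_pos {η : ℝ} (hη : 0 < η) : 0 < alphaOf η := by
  rw [alphaOf_eq hη.ne']; have := gd_pos η; positivity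

theorem lamOf_pos {η : ℝ} (hη : 0 < η) : 0 < lamOf η := by
  rw [lamOf_eq]; have := gd_pos η; positivity

theorem alphaOf_mul {η : ℝ} (hη : 0 < η) : alphaOf η * η = lamOf η := by
  rw [alphaOf]; field_simp

/-- The right side is the denominator of `davieReeds`. -/
theorem valueBound_alphaOf {η : ℝ} (hη : 0 < η) :
    valueBound (lamOf η) (alphaOf η) = alphaOf η ^ 2 + lamOf η * (1 - 4 * Phi (-η)) := by
  rw [← alphaOf_mul hη, valueBound_eq (alphaOf_pos hη) hη, alphaOf_eq hη.ne']; ring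

theorem valueBound_zero {lam : ℝ} (h : 0 ≤ lam) : valueBound lam 0 = lam := by
  simp [valueBound, h]

theorem gd_zero : gd 0 = (Real.sqrt (2 * Real.pi))⁻¹ := by simp [gd]

theorem gd_zero_gt : 0.398 < gd 0 := by
  rw [gd_zero, lt_inv_comm₀ (by norm_num) (by positivity), Real.sqrt_lt' (by norm_num)]
  have := Real.pi_lt_d4
  norm_num at this ⊢; linarith

theorem gd_ge (z : ℝ) : gd 0 * (1 - z ^ 2 / 2) ≤ gd z := by
  have h := Real.add_one_le_exp (-z ^ 2 / 2)
  have h0 : gd z = gd 0 * Real.exp (-z ^ 2 / 2) := by rw [gd_zero, gd]; field_simp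
  rw [h0]
  exact mul_le_mul_of_nonneg_left (by linarith) (gd_pos 0).le

theorem gd_antitoneOn : AntitoneOn gd (Set.Ici 0) := by
  intro a ha b hb hab
  simp only [Set.mem_Ici] at ha hb
  unfold gd
  gcongr

/-- The density decreases on [0, η], so its integral is at least length times right end value. -/
theorem mul_gd_le_Phi_sub {η : ℝ} (hη : 0 ≤ η) : η * gd η ≤ Phi η - 1 / 2 := by
  rw [← Phi_zero, Phi_sub_Phi]
  have h : ∫ _ in (0 : ℝ)..η, gd η ≤ ∫ z in (0 : ℝ)..η, gd z := by
    refine intervalIntegral.integral_mono_on hη (by simp)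
      integrable_gd.intervalIntegrable fun z hz => ?_
    exact gd_antitoneOn hz.1 (hz.1.trans hz.2) hz.2
  simpa using h

/-- This says that the critical value at h = η exceeds the limit value at h = ∞ (that is, r = 0); it
is where η < 1/2 does more than give η < 1. By Φ(-η) ≤ 1/2 - ηγ(η) it suffices that η < γ(η)(1 +
2η²), which follows from γ(η) ≥ 0.398(1 - η²/2). -/
theorem two_mul_Phi_neg_lt {η : ℝ} (h0 : 0 < η) (h1 : η < 1 / 2) : 2 * η * Phi (-η) < gd η := by
  have h2 := mul_gd_le_Phi_sub h0.le
  have h3 := gd_ge η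
  have h4 := gd_zero_gt
  rw [Phi_neg]
  have h5 : 2 * η * (1 - Phi η) ≤ 2 * η * (1 / 2 - η * gd η) :=
    mul_le_mul_of_nonneg_left (by linarith) (by linarith)
  have h6 : 0.398 * (1 - η ^ 2 / 2) ≤ gd η := le_trans (by gcongr; nlinarith) h3
  have h7 : η < 0.398 * (1 - η ^ 2 / 2) * (1 + 2 * η ^ 2) := by
    nlinarith [mul_pos h0 h0, mul_nonneg (mul_pos h0 h0).le (sub_nonneg.2 h1.le), sq_nonneg (η - 0.33)]
  have h8 : 0.398 * (1 - η ^ 2 / 2) * (1 + 2 * η ^ 2) ≤ gd η * (1 + 2 * η ^ 2) := by gcongr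
  nlinarith

theorem hasDerivAt_id_mul_gd (h : ℝ) : HasDerivAt (fun h => h * gd h) ((1 - h ^ 2) * gd h) h :=
  ((hasDerivAt_id h).mul (hasDerivAt_gd h)).congr_deriv (by simp; ring)

theorem id_mul_gd_strictMonoOn : StrictMonoOn (fun h => h * gd h) (Set.Icc 0 1) := by
  refine strictMonoOn_of_deriv_pos (convex_Icc _ _) (by have := continuous_gd; fun_prop) ?_
  intro x hx
  rw [interior_Icc] at hx
  rw [(hasDerivAt_id_mul_gd x).deriv]
  exact mul_pos (by nlinarith [hx.1, hx.2]) (gd_pos x)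

theorem id_mul_gd_strictAntiOn : StrictAntiOn (fun h => h * gd h) (Set.Ici 1) := by
  refine strictAntiOn_of_deriv_neg (convex_Ici _) (by have := continuous_gd; fun_prop) ?_
  intro x hx
  rw [interior_Ici] at hx
  rw [(hasDerivAt_id_mul_gd x).deriv]
  exact mul_neg_of_neg_of_pos (by nlinarith [Set.mem_Ioi.1 hx]) (gd_pos x)

/-- `valueBound lam r / lam` as a function of `h = lam / r`. -/
def valueRatio (lam h : ℝ) : ℝ := 1 - lam / h ^ 2 + 4 * (gd h / h) - 4 * Phi (-h)

/-- The terms ±4γ(h) from γ(h)/h and Φ(-h) cancel. For λ = 2ηγ(η) the sign is that of ηγ(η) - hγ(h).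
-/
theorem hasDerivAt_valueRatio (lam : ℝ) {h : ℝ} (hh : 0 < h) :
    HasDerivAt (valueRatio lam) (2 / h ^ 3 * (lam - 2 * (h * gd h))) h := by
  have e : valueRatio lam =
      fun h => 1 - lam / h ^ 2 + 4 * (gd h / h) - 4 * (1 - Phi h) := by
    funext h; rw [valueRatio, Phi_neg]
  rw [e]
  have h1 := (hasDerivAt_const h lam).div (hasDerivAt_pow 2 h) (by positivity)
  have h2 := ((hasDerivAt_gd h).div (hasDerivAt_id h) hh.ne').const_mul 4
  have h3 := ((hasDerivAt_Phi h).const_sub 1).const_mul 4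
  refine (((h1.const_sub 1).add h2).sub h3).congr_deriv ?_
  simp
  field_simp
  ring

theorem tendsto_valueRatio (lam : ℝ) : Tendsto (valueRatio lam) atTop (𝓝 1) := by
  have h0 : Tendsto (fun h : ℝ => gd h / h) atTop (𝓝 0) := by
    have := (tendsto_gd_atTop 0).div_atTop tendsto_id
    simpa using this
  -- The Mills bound Φ(-h) ≤ γ(h)/h: on z > h the density is at most zγ(z)/h.
  have h1 : Tendsto (fun h : ℝ => Phi (-h)) atTop (𝓝 0) := by
    refine squeeze_zero' (Eventually.of_forall fun h => Phi_nonneg _) ?_ h0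
    filter_upwards [eventually_gt_atTop 0] with h hh
    rw [le_div_iff₀ hh, ← integral_Ioi_gd, ← integral_Ioi_id_mul_gd, ← integral_mul_const]
    refine setIntegral_mono_on (integrable_gd.mul_const h).integrableOn
      integrable_id_mul_gd.integrableOn measurableSet_Ioi fun z hz => ?_
    rw [mul_comm]
    exact mul_le_mul_of_nonneg_right (le_of_lt hz) (gd_pos z).le
  have h2 : Tendsto (fun h : ℝ => lam / h ^ 2) atTop (𝓝 0) :=
    Tendsto.div_atTop tendsto_const_nhds (tendsto_pow_atTop two_ne_zero)
  have := ((h2.const_sub 1).add (h0.const_mul 4)).sub (h1.const_mul 4)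
  simpa [valueRatio, Function.comp_def, funext_iff] using! this

/-- Since hγ(h) increases on [0, 1] and decreases afterwards, the ratio increases up to η, decreases
until hγ(h) falls back to ηγ(η) at some point beyond 1, and then increases towards its limit 1. The
value at η is larger than 1. -/
theorem valueRatio_lt {η h : ℝ} (h0 : 0 < η) (h1 : η < 1 / 2) (hh : 0 < h) (hne : h ≠ η) :
    valueRatio (lamOf η) h < valueRatio (lamOf η) η := by
  have hl : lamOf η = 2 * (η * gd η) := by rw [lamOf_eq]; ring
  have hcont : ∀ s : Set ℝ, (∀ x ∈ s, 0 < x) → ContinuousOn (valueRatio (lamOf η)) s :=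
    fun s hs x hx => (hasDerivAt_valueRatio _ (hs x hx)).continuousAt.continuousWithinAt
  have hmem : η ∈ Set.Icc (0 : ℝ) 1 := ⟨h0.le, by linarith⟩
  rcases lt_or_gt_of_ne hne with hlt | hgt
  · have : StrictMonoOn (valueRatio (lamOf η)) (Set.Icc h η) := by
      refine strictMonoOn_of_deriv_pos (convex_Icc _ _)
        (hcont _ fun x hx => hh.trans_le hx.1) fun x hx => ?_
      rw [interior_Icc] at hx
      have hx0 : 0 < x := hh.trans hx.1
      rw [(hasDerivAt_valueRatio _ hx0).deriv]
      have := id_mul_gd_strictMonoOn ⟨hx0.le, by linarith [hx.2]⟩ hmem hx.2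
      simp only at this
      exact mul_pos (by positivity) (by linarith)
    exact this ⟨le_rfl, hlt.le⟩ ⟨hlt.le, le_rfl⟩ hlt
  · have h1' : 1 < valueRatio (lamOf η) η := by
      have := two_mul_Phi_neg_lt h0 h1
      rw [valueRatio, lamOf_eq]
      have e : 1 - 2 * η * gd η / η ^ 2 + 4 * (gd η / η) - 4 * Phi (-η) =
        1 + 2 / η * (gd η - 2 * η * Phi (-η)) := by field_simp; ring
      rw [e]
      have : 0 < 2 / η * (gd η - 2 * η * Phi (-η)) := mul_pos (by positivity) (by linarith)
      linarith
    -- The second critical point need not be located: the sign of the derivative at h tells on which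
    -- side h lies. Before it, the ratio decreases on all of [η, h]; after it, the ratio is monotone
    -- on [h, ∞), hence at most its limit 1.
    rcases le_or_gt (lamOf η) (2 * (h * gd h)) with hD | hD
    · have key : ∀ x ∈ Set.Ioo η h, η * gd η < x * gd x := by
        intro x hx
        rcases le_or_gt x 1 with hx1 | hx1
        · exact id_mul_gd_strictMonoOn hmem ⟨(h0.trans hx.1).le, hx1⟩ hx.1
        · have := id_mul_gd_strictAntiOn hx1.le (hx1.trans hx.2).le hx.2
          simp only at this; linarith
      have : StrictAntiOn (valueRatio (lamOf η)) (Set.Icc η h) := by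
        refine strictAntiOn_of_deriv_neg (convex_Icc _ _)
          (hcont _ fun x hx => h0.trans_le hx.1) fun x hx => ?_
        rw [interior_Icc] at hx
        have hx0 : 0 < x := h0.trans hx.1
        rw [(hasDerivAt_valueRatio _ hx0).deriv]
        have := key x hx
        exact mul_neg_of_pos_of_neg (by positivity) (by linarith)
      exact this ⟨le_rfl, hgt.le⟩ ⟨hgt.le, le_rfl⟩ hgt
    · have hh1 : 1 ≤ h := by
        by_contra! hc
        have := id_mul_gd_strictMonoOn hmem ⟨hh.le, hc.le⟩ hgt
        simp only at this; linarith
      have : MonotoneOn (valueRatio (lamOf η)) (Set.Ici h) := by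
        refine monotoneOn_of_deriv_nonneg (convex_Ici _)
          (hcont _ fun x hx => hh.trans_le hx) (fun x hx => ?_) fun x hx => ?_
        · rw [interior_Ici] at hx
          exact (hasDerivAt_valueRatio _ (hh.trans hx)).differentiableAt.differentiableWithinAt
        · rw [interior_Ici] at hx
          have hx0 : 0 < x := hh.trans hx
          rw [(hasDerivAt_valueRatio _ hx0).deriv]
          have := id_mul_gd_strictAntiOn (Set.mem_Ici.2 hh1)
            (Set.mem_Ici.2 (hh1.trans (le_of_lt hx))) hx
          simp only at this
          exact mul_nonneg (by positivity) (by linarith)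
      have hle : valueRatio (lamOf η) h ≤ 1 := by
        refine ge_of_tendsto (tendsto_valueRatio (lamOf η)) ?_
        filter_upwards [eventually_ge_atTop h] with x hx
        exact this (Set.self_mem_Ici) hx hx
      linarith

theorem valueBound_eq_mul_valueRatio {lam r : ℝ} (hl : 0 < lam) (hr : 0 < r) :
    valueBound lam r = lam * valueRatio lam (lam / r) := by
  have h := valueBound_eq hr (div_pos hl hr)
  rw [mul_div_cancel₀ _ hr.ne'] at h
  rw [h, valueRatio]
  field_simp
  ring

theorem valueBound_lt {η r : ℝ} (h0 : 0 < η) (h1 : η < 1 / 2) (hr : 0 ≤ r) (hne : r ≠ alphaOf η) :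
    valueBound (lamOf η) r < valueBound (lamOf η) (alphaOf η) := by
  have hl := lamOf_pos h0
  have ha := alphaOf_pos h0
  -- At r = 0 the substitution h = λ/r is not available; the bound there is λ, matching the ratio 1
  -- at infinity.
  rcases hr.eq_or_lt with rfl | hr
  · rw [valueBound_zero hl.le, valueBound_alphaOf h0, lamOf_eq, alphaOf_eq h0.ne']
    have := two_mul_Phi_neg_lt h0 h1
    have hg := gd_pos η
    nlinarith
  · rw [valueBound_eq_mul_valueRatio hl hr, valueBound_eq_mul_valueRatio hl ha]
    have e : lamOf η / alphaOf η = η := by rw [← alphaOf_mul h0]; field_simp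
    rw [e]
    refine mul_lt_mul_of_pos_left (valueRatio_lt h0 h1 (div_pos hl hr) ?_) hl
    rintro hc
    apply hne
    rw [alphaOf]
    field_simp at hc ⊢
    linarith

/-! ### Gaussian vectors: integrability, one-dimensional marginals, independence -/

variable {n : ℕ}

/-- Membership in `L^q(γ_n)` for every finite `q`. -/
def AllLp (f : E n → ℝ) : Prop := ∀ q : ENNReal, q ≠ ⊤ → MemLp f q (gam n)

namespace AllLp

theorem inner (v : E n) : AllLp fun x => inner ℝ v x :=
  fun q hq => IsGaussian.memLp_dual (gam n) (innerSL ℝ v) q hq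

theorem const (c : ℝ) : AllLp fun _ : E n => c := fun _ _ => memLp_const c

theorem add {f g : E n → ℝ} (hf : AllLp f) (hg : AllLp g) : AllLp fun x => f x + g x :=
  fun q hq => (hf q hq).add (hg q hq)

theorem sub {f g : E n → ℝ} (hf : AllLp f) (hg : AllLp g) : AllLp fun x => f x - g x :=
  fun q hq => (hf q hq).sub (hg q hq)

theorem mul {f g : E n → ℝ} (hf : AllLp f) (hg : AllLp g) : AllLp fun x => f x * g x := by
  intro q hq
  -- Hölder with exponents 2q, 2q: having all finite exponents makes the class closed under
  -- products.
  have : ENNReal.HolderTriple (2 * q) (2 * q) q := ⟨by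
    rw [ENNReal.mul_inv (Or.inl (by norm_num)) (Or.inl (by norm_num)), ← add_mul,
      ENNReal.inv_two_add_inv_two, one_mul]⟩
  have h2 : 2 * q ≠ ⊤ := ENNReal.mul_ne_top (by norm_num) hq
  exact (hg _ h2).mul (hf _ h2)

theorem const_mul {f : E n → ℝ} (c : ℝ) (hf : AllLp f) : AllLp fun x => c * f x :=
  (const c).mul hf

theorem pow {f : E n → ℝ} (hf : AllLp f) (k : ℕ) : AllLp fun x => f x ^ k := by
  induction k with
  | zero => simpa using const 1
  | succ k ih => simpa only [pow_succ] using ih.mul hf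

theorem abs {f : E n → ℝ} (hf : AllLp f) : AllLp fun x => |f x| :=
  fun q hq => (hf q hq).norm

theorem integrable {f : E n → ℝ} (hf : AllLp f) : Integrable f (gam n) :=
  memLp_one_iff_integrable.1 (hf 1 (by norm_num))

theorem memLp_two {f : E n → ℝ} (hf : AllLp f) : MemLp f 2 (gam n) := hf 2 (by norm_num)

theorem bdd_mul {f g : E n → ℝ} {c : ℝ} (hg : Measurable g) (hc : ∀ x, |g x| ≤ c)
    (hf : AllLp f) : AllLp fun x => g x * f x :=
  fun q hq => MemLp.of_le_mul (c := c) (hf q hq) (hg.aestronglyMeasurable.mul (hf q hq).1)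
    (Eventually.of_forall fun x => by
      simp only [norm_mul]
      exact mul_le_mul_of_nonneg_right (hc x) (norm_nonneg _))

end AllLp

theorem measurePreserving_inner {u : E n} (hu : ‖u‖ = 1) :
    MeasurePreserving (fun x => inner ℝ u x) (gam n) (gaussianReal 0 1) where
  measurable := by fun_prop
  map_eq := by
    have h := IsGaussian.map_eq_gaussianReal (μ := gam n) (innerSL ℝ u)
    rw [integral_strongDual_stdGaussian, variance_dual_stdGaussian] at h
    simp only [innerSL_apply_norm, hu] at h
    simpa using! h

theorem integral_comp_inner {u : E n} (hu : ‖u‖ = 1) {F : ℝ → ℝ} (hF : Measurable F) :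
    ∫ x, F (inner ℝ u x) ∂gam n = ∫ z, F z ∂gaussianReal 0 1 := by
  rw [← (measurePreserving_inner hu).map_eq,
    integral_map (by fun_prop) hF.aestronglyMeasurable]

/-- The component of `x` orthogonal to the unit vector `u`. -/
def perp (u x : E n) : E n := x - inner ℝ u x • u

theorem measurable_perp (u : E n) : Measurable (perp u) := by unfold perp; fun_prop

theorem inner_perp {u v : E n} (h : inner ℝ u v = 0) (x : E n) :
    inner ℝ v (perp u x) = inner ℝ v x := by
  rw [perp, inner_sub_right, inner_smul_right, real_inner_comm u v, h]; simp

theorem integral_inner_mul_inner (v w : E n) :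
    ∫ x, inner ℝ v x * inner ℝ w x ∂gam n = inner ℝ v w := by
  have h := covarianceBilin_apply_eq_cov (μ := gam n) IsGaussian.memLp_two_id v w
  rw [covarianceBilin_stdGaussian, covariance] at h
  have h0 : ∀ v : E n, ∫ x, inner ℝ v x ∂gam n = 0 := fun v =>
    integral_strongDual_stdGaussian (innerSL ℝ v)
  simp only [h0, sub_zero] at h
  rw [← h]; rfl

/-- Both are linear images of one Gaussian vector, hence jointly Gaussian, so vanishing covariance
suffices; it reduces to ⟨u, y - ⟨u, y⟩u⟩ = 0. -/
theorem indepFun_perp {u : E n} (hu : ‖u‖ = 1) :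
    IndepFun (fun x => inner ℝ u x) (perp u) (gam n) := by
  let T : E n →L[ℝ] ℝ × E n :=
    (innerSL ℝ u).prod (ContinuousLinearMap.id ℝ (E n) - (innerSL ℝ u).smulRight u)
  have hT : HasGaussianLaw (fun x : E n => (inner ℝ u x, perp u x)) (gam n) :=
    IsGaussian.hasGaussianLaw_id.map T
  refine hT.indepFun_of_covariance_inner fun a y => ?_
  have h0 : ∀ v : E n, ∫ x, inner ℝ v x ∂gam n = 0 := fun v =>
    integral_strongDual_stdGaussian (innerSL ℝ v)
  have e1 : (fun x : E n => inner ℝ a (inner ℝ u x)) = fun x => inner ℝ (a • u) x := by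
    funext x; rw [inner_smul_left]; simp [mul_comm]
  have e2 : (fun x : E n => inner ℝ y (perp u x)) = fun x => inner ℝ (perp u y) x := by
    funext x
    rw [perp, perp, inner_sub_right, inner_sub_left, inner_smul_left, inner_smul_right,
      real_inner_comm u y]
    simp [mul_comm]
  rw [e1, e2, covariance]
  simp only [h0, sub_zero]
  rw [integral_inner_mul_inner, perp, inner_sub_right, inner_smul_left, inner_smul_left,
    inner_smul_right, real_inner_self_eq_norm_sq, hu]
  simp

/-- Factorization of expectations over `Z = ⟨u, X⟩` and the orthogonal component. -/
theorem integral_mul_perp {u : E n} (hu : ‖u‖ = 1) {F : ℝ → ℝ} (hF : Measurable F)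
    {q : E n → ℝ} (hq : Measurable q) :
    ∫ x, F (inner ℝ u x) * q (perp u x) ∂gam n =
      (∫ z, F z ∂gaussianReal 0 1) * ∫ x, q (perp u x) ∂gam n := by
  rw [← integral_comp_inner hu hF]
  exact (indepFun_perp hu).integral_fun_comp_mul_comp (by fun_prop)
    (measurable_perp u).aemeasurable hF.aestronglyMeasurable hq.aestronglyMeasurable

theorem integral_inner_eq_zero (v : E n) : ∫ x, inner ℝ v x ∂gam n = 0 :=
  integral_strongDual_stdGaussian (innerSL ℝ v)

/-! ### First moments and the pointwise gap inequality -/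

theorem integrable_smul_id {g : E n → ℝ} (hg : g ∈ unitFunctions n) :
    Integrable (fun x => g x • x) (gam n) := by
  refine (IsGaussian.integrable_id (μ := gam n)).mono
    (hg.1.aestronglyMeasurable.smul (by fun_prop)) (Eventually.of_forall fun x => ?_)
  rw [norm_smul]
  exact mul_le_of_le_one_left (norm_nonneg _) (hg.2 x)

theorem inner_firstMoment {g : E n → ℝ} (hg : g ∈ unitFunctions n) (v : E n) :
    inner ℝ v (firstMoment g) = ∫ x, g x * inner ℝ v x ∂gam n := by
  rw [firstMoment, ← integral_inner (integrable_smul_id hg)]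
  simp [inner_smul_right]

theorem P1_eq {g : E n → ℝ} (hg : g ∈ unitFunctions n) (x : E n) :
    P1 g x = inner ℝ (firstMoment g) x := by
  rw [real_inner_comm, inner_firstMoment hg, P1]
  simp [mul_comm]

theorem integral_mul_inner_firstMoment {g : E n → ℝ} (hg : g ∈ unitFunctions n) :
    ∫ x, inner ℝ (firstMoment g) x * g x ∂gam n = ‖firstMoment g‖ ^ 2 := by
  rw [← real_inner_self_eq_norm_sq, inner_firstMoment hg]
  simp [mul_comm]

/-- The left side is convex in g, so g = ±1 are the extreme cases; there it equals λ + 2 max(±w - λ,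
0). -/
theorem abs_sub_add_mul_le {lam w g : ℝ} (hg : |g| ≤ 1) :
    |w - lam * g| + w * g ≤ lam + 2 * max (|w| - lam) 0 := by
  obtain ⟨h1, h2⟩ := abs_le.1 hg
  have m1 := le_max_left (|w| - lam) 0
  have m2 := le_max_right (|w| - lam) 0
  have m3 := le_abs_self w
  have m4 := neg_abs_le w
  rcases abs_cases (w - lam * g) with ⟨h, -⟩ | ⟨h, -⟩ <;> rw [h]
  · nlinarith
  · nlinarith

theorem integral_max_abs_inner (lam : ℝ) (m : E n) :
    ∫ x, max (|inner ℝ m x| - lam) 0 ∂gam n =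
      ∫ z, max (‖m‖ * |z| - lam) 0 ∂gaussianReal 0 1 := by
  rcases eq_or_ne m 0 with rfl | hm
  · simp
  · have hu : ‖‖m‖⁻¹ • m‖ = 1 := norm_smul_inv_norm hm
    rw [← integral_comp_inner hu (F := fun z => max (‖m‖ * |z| - lam) 0) (by fun_prop)]
    congr 1; funext x
    rw [inner_smul_left, abs_mul, ← mul_assoc]
    simp [hm]

theorem integrable_gap {g : E n → ℝ} (lam : ℝ) (hg : g ∈ unitFunctions n) :
    Integrable (fun x => |R lam g x|) (gam n) ∧
    Integrable (fun x => inner ℝ (firstMoment g) x * g x) (gam n) ∧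
    Integrable (fun x => max (|inner ℝ (firstMoment g) x| - lam) 0) (gam n) := by
  have hgi : Integrable g (gam n) := by
    simpa using (AllLp.bdd_mul hg.1 hg.2 (AllLp.const 1)).integrable
  have h2 : Integrable (fun x => inner ℝ (firstMoment g) x * g x) (gam n) := by
    simpa [mul_comm] using (AllLp.bdd_mul hg.1 hg.2 (AllLp.inner (firstMoment g))).integrable
  refine ⟨?_, h2, ?_⟩
  · simp_rw [R, P1_eq hg]
    exact ((AllLp.inner (firstMoment g)).integrable.sub (hgi.const_mul lam)).abs
  · exact ((AllLp.inner (firstMoment g)).integrable.abs.sub (integrable_const lam)).sup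
      (integrable_const 0)

/-- The integrand of the difference between `valueBound lam ‖m‖` and `‖R_lam g‖₁`. -/
def gap (lam : ℝ) (g : E n → ℝ) (x : E n) : ℝ :=
  lam + 2 * max (|inner ℝ (firstMoment g) x| - lam) 0 -
    (|R lam g x| + inner ℝ (firstMoment g) x * g x)

theorem gap_nonneg {lam : ℝ} {g : E n → ℝ} (hg : g ∈ unitFunctions n) (x : E n) :
    0 ≤ gap lam g x := by
  rw [gap, R, P1_eq hg, sub_nonneg]
  exact abs_sub_add_mul_le (hg.2 x)

theorem integrable_gap' {g : E n → ℝ} (lam : ℝ) (hg : g ∈ unitFunctions n) :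
    Integrable (gap lam g) (gam n) := by
  obtain ⟨h1, h2, h3⟩ := integrable_gap lam hg
  exact ((integrable_const lam).add (h3.const_mul 2)).sub (h1.add h2)

/-- The term -r² of `valueBound` arises from E[⟨m, X⟩ g(X)] = ‖m‖². With `gap_nonneg` this is the
upper bound for ‖R_λ g‖₁ together with its equality case. -/
theorem integral_gap {g : E n → ℝ} (lam : ℝ) (hg : g ∈ unitFunctions n) :
    ∫ x, gap lam g x ∂gam n = valueBound lam ‖firstMoment g‖ - ∫ x, |R lam g x| ∂gam n := by
  obtain ⟨h1, h2, h3⟩ := integrable_gap lam hg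
  unfold gap
  rw [integral_sub, integral_add (integrable_const lam) (h3.const_mul 2), integral_add h1 h2,
    integral_const_mul, integral_max_abs_inner, integral_mul_inner_firstMoment hg, valueBound]
  · simp
    ring
  · exact (integrable_const lam).add (h3.const_mul 2)
  · exact h1.add h2

/-! ### Extremal functions and the structure of maximizers -/

/-- The extremal function `1` on `|z| < η` and `sign z` elsewhere. -/
def extremal (η z : ℝ) : ℝ := if |z| < η then 1 else Real.sign z

theorem measurable_sign : Measurable Real.sign := by
  unfold Real.sign
  exact Measurable.ite measurableSet_Iio measurable_const
    (Measurable.ite measurableSet_Ioi measurable_const measurable_const)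

theorem measurable_extremal (η : ℝ) : Measurable (extremal η) :=
  Measurable.ite (measurableSet_abs_lt η) measurable_const measurable_sign

theorem abs_sign_le (z : ℝ) : |Real.sign z| ≤ 1 := by
  rcases Real.sign_apply_eq z with h | h | h <;> simp [h]

theorem abs_extremal_le (η z : ℝ) : |extremal η z| ≤ 1 := by
  unfold extremal; split_ifs
  · simp
  · exact abs_sign_le z

theorem integrable_abs_gaussian : Integrable (fun z : ℝ => |z|) (gaussianReal 0 1) := by
  simpa using (integrable_pow_gaussian 1).abs

theorem integral_abs_gaussian : ∫ z, |z| ∂gaussianReal 0 1 = 2 * gd 0 := by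
  rw [integral_gaussian']
  have h1 : ∀ z : ℝ, |z| * gd z = (fun w => w * gd w) |z| := by
    intro z
    rcases abs_choice z with h | h <;> simp [h, gd_neg]
  simp_rw [h1]
  rw [integral_comp_abs (f := fun w => w * gd w), integral_Ioi_id_mul_gd]

theorem setIntegral_id_gaussian {η : ℝ} (hη : 0 < η) :
    ∫ z in {z : ℝ | |z| < η}, z ∂gaussianReal 0 1 = 0 := by
  rw [setIntegral_abs_lt hη,
    intervalIntegral.integral_eq_sub_of_hasDerivAt (f := fun z => -gd z)
      (f' := fun z => z * gd z) (fun z _ => (hasDerivAt_gd z).neg.congr_deriv (by ring))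
      (Continuous.intervalIntegrable (by have := continuous_gd; fun_prop) _ _)]
  rw [gd_neg]; ring

/-- By parity the constant 1 in the slab contributes nothing, which leaves E|Z| - s₁ = 2γ(η). -/
theorem integral_extremal {η : ℝ} (hη : 0 < η) :
    ∫ z, extremal η z * z ∂gaussianReal 0 1 = alphaOf η := by
  have hs := measurableSet_abs_lt η
  have e : (fun z => extremal η z * z) = fun z =>
      |z| - {z : ℝ | |z| < η}.indicator (fun z => |z|) z
        + {z : ℝ | |z| < η}.indicator (fun z => z) z := by
    funext z
    by_cases h : |z| < η
    · simp [extremal, h]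
    · simp only [extremal, h, if_false, Set.indicator, Set.mem_ofPred_eq]
      rcases lt_trichotomy z 0 with h | h | h
      · simp [Real.sign_of_neg h, abs_of_neg h]
      · simp [h]
      · simp [Real.sign_of_pos h, abs_of_pos h]
  have hi : Integrable (fun z : ℝ => z) (gaussianReal 0 1) := by
    simpa using integrable_pow_gaussian 1
  have hs₁ := s₁_eq hη
  rw [s₁] at hs₁
  rw [e, integral_add, integral_sub integrable_abs_gaussian (integrable_abs_gaussian.indicator hs),
    integral_indicator hs, integral_indicator hs, setIntegral_id_gaussian hη,
    integral_abs_gaussian, hs₁, alphaOf_eq hη.ne']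
  · ring
  · exact integrable_abs_gaussian.sub (integrable_abs_gaussian.indicator hs)
  · exact hi.indicator hs

theorem extremal_mem (η : ℝ) (e : E n) :
    (fun x => extremal η (inner ℝ e x)) ∈ unitFunctions n :=
  ⟨(measurable_extremal η).comp (by fun_prop), fun _ => abs_extremal_le _ _⟩

/-- Test against v, split along e and orthogonally to e: the orthogonal part is independent of the
function and centred. -/
theorem firstMoment_extremal {η : ℝ} (hη : 0 < η) {e : E n} (he : ‖e‖ = 1) :
    firstMoment (fun x => extremal η (inner ℝ e x)) = alphaOf η • e := by
  have hm := extremal_mem η e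
  refine ext_inner_left ℝ fun v => ?_
  rw [inner_firstMoment hm, inner_smul_right]
  have hw : inner ℝ e (perp e v) = 0 := by
    rw [perp, inner_sub_right, inner_smul_right, real_inner_self_eq_norm_sq, he]; ring
  have hv : ∀ x, inner ℝ v x = inner ℝ v e * inner ℝ e x + inner ℝ (perp e v) (perp e x) := by
    intro x
    rw [inner_perp hw, perp, inner_sub_left, inner_smul_left, real_inner_comm e v]
    simp
  have h1 : ∫ x, extremal η (inner ℝ e x) * inner ℝ (perp e v) (perp e x) ∂gam n = 0 := by
    rw [integral_mul_perp he (measurable_extremal η) (q := fun y => inner ℝ (perp e v) y)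
      (by fun_prop)]
    simp only [inner_perp hw, integral_inner_eq_zero, mul_zero]
  have h2 : ∫ x, extremal η (inner ℝ e x) * inner ℝ e x ∂gam n = alphaOf η := by
    rw [integral_comp_inner he (F := fun z => extremal η z * z)
      ((measurable_extremal η).mul measurable_id), integral_extremal hη]
  have h3 : ∫ x, extremal η (inner ℝ e x) * inner ℝ v x ∂gam n =
      ∫ x, (inner ℝ v e * (extremal η (inner ℝ e x) * inner ℝ e x) +
        extremal η (inner ℝ e x) * inner ℝ (perp e v) (perp e x)) ∂gam n := by
    congr 1; funext x
    rw [hv]; ring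
  rw [h3, integral_add, h1, integral_const_mul, h2]
  · ring
  · exact (AllLp.bdd_mul hm.1 hm.2 (AllLp.inner e)).integrable.const_mul _
  · simp_rw [inner_perp hw]
    exact (AllLp.bdd_mul hm.1 hm.2 (AllLp.inner _)).integrable

/-- The equality case of `abs_sub_add_mul_le`: for |w| < λ the value 1 is optimal, for |w| ≥ λ the
value sign w. -/
theorem gap_extremal {η : ℝ} (hη : 0 < η) {e : E n} (he : ‖e‖ = 1) (x : E n) :
    gap (lamOf η) (fun x => extremal η (inner ℝ e x)) x = 0 := by
  rw [gap, R, P1_eq (extremal_mem η e), firstMoment_extremal hη he, inner_smul_left]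
  have ha := alphaOf_pos hη
  rw [← alphaOf_mul hη]
  generalize alphaOf η = a at *
  simp only [conj_trivial]
  generalize (inner ℝ e x : ℝ) = z
  unfold extremal
  rw [abs_mul, abs_of_pos ha]
  split_ifs with h
  · rw [max_eq_right (by nlinarith), abs_of_neg (by nlinarith [(abs_lt.1 h).2])]
    ring
  · push Not at h
    rw [max_eq_left (by nlinarith)]
    rcases lt_trichotomy z 0 with h1 | h1 | h1
    · rw [abs_of_neg h1] at h ⊢
      rw [Real.sign_of_neg h1, abs_of_nonpos (by nlinarith)]
      ring
    · rw [h1, abs_zero] at h; linarith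
    · rw [abs_of_pos h1] at h ⊢
      rw [Real.sign_of_pos h1, abs_of_nonneg (by nlinarith)]
      ring

theorem integral_R_extremal {η : ℝ} (hη : 0 < η) {e : E n} (he : ‖e‖ = 1) :
    ∫ x, |R (lamOf η) (fun x => extremal η (inner ℝ e x)) x| ∂gam n =
      valueBound (lamOf η) (alphaOf η) := by
  have h := integral_gap (lamOf η) (extremal_mem η e)
  simp_rw [gap_extremal hη he, firstMoment_extremal hη he, norm_smul, he] at h
  simp [abs_of_pos (alphaOf_pos hη)] at h
  linarith

/-- The structure of a maximizer: the length of its first moment is determined, and it equals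
`sign Z` where `|Z| > η`. -/
theorem maximizer_structure {η : ℝ} (h0 : 0 < η) (h1 : η < 1 / 2) (hn : 1 ≤ n) {g : E n → ℝ}
    (hg : IsMaximizer (lamOf η) g) :
    ‖firstMoment g‖ = alphaOf η ∧
      ∀ᵐ x ∂gam n, η < |inner ℝ (dir g) x| → g x = Real.sign (inner ℝ (dir g) x) := by
  have hl := lamOf_pos h0
  have ha := alphaOf_pos h0
  obtain ⟨hgu, hmax⟩ := hg
  -- A unit vector for the competitor; this is where n ≥ 1 is needed.
  let e : E n := EuclideanSpace.single ⟨0, hn⟩ 1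
  have he : ‖e‖ = 1 := by simp [e]
  have hle : valueBound (lamOf η) (alphaOf η) ≤ ∫ x, |R (lamOf η) g x| ∂gam n := by
    rw [← integral_R_extremal h0 he]
    exact hmax (extremal_mem η e)
  have hgap := integral_gap (lamOf η) hgu
  have hnn : 0 ≤ ∫ x, gap (lamOf η) g x ∂gam n := integral_nonneg fun x => gap_nonneg hgu x
  have hnorm : ‖firstMoment g‖ = alphaOf η := by
    by_contra hne
    have := valueBound_lt h0 h1 (norm_nonneg _) hne
    linarith
  refine ⟨hnorm, ?_⟩
  have hz : ∫ x, gap (lamOf η) g x ∂gam n = 0 := by rw [hnorm] at hgap; linarith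
  have hae := (integral_eq_zero_iff_of_nonneg (fun x => gap_nonneg hgu x)
    (integrable_gap' _ hgu)).1 hz
  filter_upwards [hae] with x hx hxη
  have hm : firstMoment g = alphaOf η • dir g := by
    rw [dir, hnorm, smul_smul, mul_inv_cancel₀ ha.ne', one_smul]
  have hb := hgu.2 x
  simp only [gap, R, P1_eq hgu, Pi.zero_apply] at hx
  rw [hm, inner_smul_left, ← alphaOf_mul h0] at hx
  simp only [conj_trivial] at hx
  generalize alphaOf η = a at *
  generalize (inner ℝ (dir g) x : ℝ) = z at *
  generalize g x = t at *
  obtain ⟨hb1, hb2⟩ := abs_le.1 hb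
  rw [abs_mul, abs_of_pos ha, max_eq_left (by nlinarith)] at hx
  rcases lt_trichotomy z 0 with h2 | h2 | h2
  · rw [abs_of_neg h2] at hxη hx
    rw [Real.sign_of_neg h2]
    -- With the sign inside the absolute value known, the vanishing gap factors as (|w| - λ)(1 + t)
    -- = 0 with a positive first factor. The case z > 0 is symmetric.
    have h3 : a * z - a * η * t < 0 := by nlinarith [mul_pos ha h0]
    rw [abs_of_neg h3] at hx
    have h4 : (a * (-z) - a * η) * (1 + t) = 0 := by linarith
    rcases mul_eq_zero.1 h4 with h5 | h5
    · nlinarith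
    · linarith
  · rw [h2, abs_zero] at hxη; linarith
  · rw [abs_of_pos h2] at hxη hx
    rw [Real.sign_of_pos h2]
    have h3 : 0 < a * z - a * η * t := by nlinarith [mul_pos ha h0]
    rw [abs_of_pos h3] at hx
    have h4 : (a * z - a * η) * (1 - t) = 0 := by linarith
    rcases mul_eq_zero.1 h4 with h5 | h5
    · nlinarith
    · linarith

/-! ### Orthogonal projections onto finite-dimensional subspaces of `L²(γ_n)` -/

/-- The orthogonal projection onto the closure of `K`. -/
def projLp (K : Submodule ℝ (Lp ℝ 2 (gam n))) (f : Lp ℝ 2 (gam n)) : Lp ℝ 2 (gam n) :=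
  K.topologicalClosure.starProjection f

theorem proj_eq (K : Submodule ℝ (Lp ℝ 2 (gam n))) {f : E n → ℝ} (hf : MemLp f 2 (gam n)) :
    proj K f = ⇑(projLp K (hf.toLp f)) := by
  rw [proj, dif_pos hf]; rfl

theorem topologicalClosure_eq (K : Submodule ℝ (Lp ℝ 2 (gam n))) [FiniteDimensional ℝ K] : K.topologicalClosure = K :=
  IsClosed.submodule_topologicalClosure_eq (Submodule.closed_of_finiteDimensional K)

theorem projLp_mem (K : Submodule ℝ (Lp ℝ 2 (gam n))) [FiniteDimensional ℝ K]
    (f : Lp ℝ 2 (gam n)) : projLp K f ∈ K := by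
  have h := Submodule.starProjection_apply_mem K.topologicalClosure f
  exact (topologicalClosure_eq K).le h

theorem inner_sub_projLp {K : Submodule ℝ (Lp ℝ 2 (gam n))} (f : Lp ℝ 2 (gam n)) {w : Lp ℝ 2 (gam n)} (hw : w ∈ K) :
    inner ℝ (f - projLp K f) w = 0 :=
  Submodule.starProjection_inner_eq_zero f w (K.le_topologicalClosure hw)

theorem projLp_unique {K : Submodule ℝ (Lp ℝ 2 (gam n))} [FiniteDimensional ℝ K]
    {f y : Lp ℝ 2 (gam n)} (hy : y ∈ K)
    (h : ∀ w ∈ K, inner ℝ (f - y) w = 0) : projLp K f = y :=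
  (Submodule.eq_starProjection_of_mem_of_inner_eq_zero (K.le_topologicalClosure hy)
    (by rw [topologicalClosure_eq K]; exact h))

theorem projLp_sup {K L : Submodule ℝ (Lp ℝ 2 (gam n))} [FiniteDimensional ℝ K]
    [FiniteDimensional ℝ L]
    (hKL : ∀ x ∈ K, ∀ y ∈ L, inner ℝ x y = 0) (f : Lp ℝ 2 (gam n)) :
    projLp (K ⊔ L) f = projLp K f + projLp L f := by
  refine projLp_unique (Submodule.add_mem_sup (projLp_mem K f) (projLp_mem L f)) fun w hw => ?_
  obtain ⟨x, hx, y, hy, rfl⟩ := Submodule.mem_sup.1 hw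
  have h1 := inner_sub_projLp f hx
  have h2 := inner_sub_projLp f hy
  have h3 := hKL _ hx _ (projLp_mem L f)
  have h4 := hKL _ (projLp_mem K f) _ hy
  rw [real_inner_comm] at h3
  simp only [inner_sub_left, inner_add_left, inner_add_right] at *
  linarith

/-! ### The trilinear Wick product -/

/-- The Wick product of three linear forms. -/
def wick (a b c x : E n) : ℝ :=
  inner ℝ a x * inner ℝ b x * inner ℝ c x - inner ℝ a b * inner ℝ c x - inner ℝ a c * inner ℝ b x
    - inner ℝ b c * inner ℝ a x

theorem allLp_wick (a b c : E n) : AllLp (wick a b c) :=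
  (((((AllLp.inner a).mul (AllLp.inner b)).mul (AllLp.inner c)).sub
    ((AllLp.inner c).const_mul _)).sub ((AllLp.inner b).const_mul _)).sub
    ((AllLp.inner a).const_mul _)

/-- The Wick product as an element of `L²(γ_n)`. -/
def wickLp (a b c : E n) : Lp ℝ 2 (gam n) := (allLp_wick a b c).memLp_two.toLp _

theorem coeFn_wickLp (a b c : E n) : ⇑(wickLp a b c) =ᵐ[gam n] wick a b c :=
  MemLp.coeFn_toLp _

theorem eq_wickLp {φ : Lp ℝ 2 (gam n)} {a b c : E n} (h : φ =ᵐ[gam n] wick a b c) :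
    φ = wickLp a b c := Lp.ext (h.trans (coeFn_wickLp a b c).symm)

/-- A transposition and a rotation generate all permutations, so linearity in the first argument
carries over to the other two. -/
theorem wickLp_swap (a b c : E n) : wickLp a b c = wickLp b a c := by
  refine eq_wickLp ((coeFn_wickLp a b c).trans (Eventually.of_forall fun x => ?_))
  simp only [wick, real_inner_comm a b]; ring

theorem wickLp_rotate (a b c : E n) : wickLp a b c = wickLp b c a := by
  refine eq_wickLp ((coeFn_wickLp a b c).trans (Eventually.of_forall fun x => ?_))
  simp only [wick, real_inner_comm a b, real_inner_comm a c]; ring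

/-- The Wick product as a linear map in its first argument. -/
def wickLin (b c : E n) : E n →ₗ[ℝ] Lp ℝ 2 (gam n) where
  toFun a := wickLp a b c
  map_add' a a' := by
    symm
    refine eq_wickLp ((Lp.coeFn_add _ _).trans ?_)
    filter_upwards [coeFn_wickLp a b c, coeFn_wickLp a' b c] with x h1 h2
    simp only [Pi.add_apply, h1, h2, wick, inner_add_left]; ring
  map_smul' r a := by
    symm
    refine eq_wickLp ((Lp.coeFn_smul _ _).trans ?_)
    filter_upwards [coeFn_wickLp a b c] with x h1
    simp only [Pi.smul_apply, h1, wick, inner_smul_left, smul_eq_mul, conj_trivial,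
      RingHom.id_apply]; ring

theorem wickLp_add (a a' b c : E n) : wickLp (a + a') b c = wickLp a b c + wickLp a' b c :=
  (wickLin b c).map_add a a'

theorem wickLp_smul (r : ℝ) (a b c : E n) : wickLp (r • a) b c = r • wickLp a b c :=
  (wickLin b c).map_smul r a

/-- If a subspace contains the Wick products of the vectors of a spanning set, then it contains
all of them. -/
theorem wickLp_mem_of_span {S : Submodule ℝ (Lp ℝ 2 (gam n))} {s : Set (E n)}
    (hs : Submodule.span ℝ s = ⊤) (h : ∀ a ∈ s, ∀ b ∈ s, ∀ c ∈ s, wickLp a b c ∈ S)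
    (a b c : E n) : wickLp a b c ∈ S := by
  have key : ∀ b c : E n, (∀ a ∈ s, wickLp a b c ∈ S) → ∀ a, wickLp a b c ∈ S := by
    intro b c hb a
    have : Submodule.span ℝ s ≤ S.comap (wickLin b c) := Submodule.span_le.2 fun a ha => hb a ha
    rw [hs] at this
    exact this (Submodule.mem_top (x := a))
  refine key b c (fun a ha => ?_) a
  rw [wickLp_rotate]
  refine key c a (fun b hb => ?_) b
  rw [wickLp_rotate]
  refine key a b (fun c hc => ?_) c
  rw [wickLp_rotate]
  exact h a ha b hb c hc

/-- The standard basis vectors. -/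
def ee (i : Fin n) : E n := EuclideanSpace.single i 1

theorem span_ee : Submodule.span ℝ (Set.range (ee (n := n))) = ⊤ := by
  have h := (EuclideanSpace.basisFun (Fin n) ℝ).toBasis.span_eq
  have e : ⇑(EuclideanSpace.basisFun (Fin n) ℝ).toBasis = ee := by
    funext i; simp [ee]
  rwa [e] at h

theorem inner_ee (i : Fin n) (x : E n) : inner ℝ (ee i) x = x i := by
  simp [ee, EuclideanSpace.inner_single_left]

theorem H_zero (z : ℝ) : H 0 z = 1 := by simp [H]

/-- The multi-index of a product of three coordinates. -/
def idx (i j k : Fin n) : Fin n → ℕ := Pi.single i 1 + Pi.single j 1 + Pi.single k 1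

/-- The contractions ⟨e_i, e_j⟩ supply exactly the lower-order terms: H₃ if all indices agree, H₂H₁
if two agree, and a plain product otherwise. -/
theorem prod_H_idx (i j k : Fin n) (x : E n) :
    ∏ l, H (idx i j k l) (x l) = wick (ee i) (ee j) (ee k) x := by
  rw [← Finset.prod_subset (Finset.subset_univ {i, j, k})]
  · simp only [wick, inner_ee, idx]
    by_cases h1 : i = j
    · subst h1
      by_cases h2 : i = k
      · subst h2
        simp [ee, H_three]; ring
      · simp [ee, h2, Ne.symm h2, H_two, H_one]; ring
    · by_cases h2 : i = k
      · subst h2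
        rw [Finset.pair_comm, Finset.insert_eq_of_mem (by simp)]
        simp [ee, h1, Ne.symm h1, H_two, H_one]; ring
      · by_cases h3 : j = k
        · subst h3
          simp [ee, h1, Ne.symm h1, H_two, H_one]; ring
        · simp [ee, h1, h2, h3, Ne.symm h1, Ne.symm h2, Ne.symm h3, H_one]; ring
  · intro l _ hl
    simp only [Finset.mem_insert, Finset.mem_singleton, not_or] at hl
    simp [idx, hl, H_zero]

theorem exists_single_add {k : ℕ} {a : Fin n → ℕ} (h : ∑ i, a i = k + 1) :
    ∃ i, ∃ b : Fin n → ℕ, a = Pi.single i 1 + b ∧ ∑ i, b i = k := by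
  obtain ⟨i, -, hi⟩ : ∃ i ∈ Finset.univ, a i ≠ 0 := by
    by_contra! hc
    rw [Finset.sum_eq_zero hc] at h; omega
  have e : a = Pi.single i 1 + (a - Pi.single i 1) := by
    funext l
    by_cases hl : l = i
    · subst hl; simp; omega
    · simp [hl]
  refine ⟨i, a - Pi.single i 1, e, ?_⟩
  have : ∑ l, a l = ∑ l, (Pi.single i 1 + (a - Pi.single i 1) : Fin n → ℕ) l := by rw [← e]
  simp only [Pi.add_apply, Finset.sum_add_distrib] at this
  rw [Finset.sum_pi_single'] at this
  simp at this ⊢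
  omega

theorem exists_idx {a : Fin n → ℕ} (h : ∑ i, a i = 3) : ∃ i j k, a = idx i j k := by
  obtain ⟨i, b, rfl, hb⟩ := exists_single_add h
  obtain ⟨j, c, rfl, hc⟩ := exists_single_add hb
  obtain ⟨k, d, rfl, hd⟩ := exists_single_add hc
  have : d = 0 := by
    funext l
    simpa using (Finset.sum_eq_zero_iff.1 hd l (Finset.mem_univ l))
  refine ⟨i, j, k, ?_⟩
  rw [this, idx]; simp [add_assoc]

theorem sum_idx (i j k : Fin n) : ∑ l, idx i j k l = 3 := by
  simp [idx, Finset.sum_add_distrib]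

/-- A finite spanning family, whence finite dimension, in a form where multilinearity can be used.
-/
theorem chaos_three_eq : chaos n 3 = Submodule.span ℝ
    (Set.range fun t : Fin n × Fin n × Fin n => wickLp (ee t.1) (ee t.2.1) (ee t.2.2)) := by
  rw [chaos]
  congr 1
  ext φ
  simp only [Set.mem_ofPred_eq, Set.mem_range, Prod.exists]
  constructor
  · rintro ⟨a, ha, hφ⟩
    obtain ⟨i, j, k, rfl⟩ := exists_idx ha
    simp_rw [prod_H_idx] at hφ
    exact ⟨i, j, k, (eq_wickLp hφ).symm⟩
  · rintro ⟨i, j, k, rfl⟩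
    refine ⟨idx i j k, sum_idx i j k, ?_⟩
    simp_rw [prod_H_idx]
    exact coeFn_wickLp _ _ _

instance : FiniteDimensional ℝ (chaos n 3) := by
  rw [chaos_three_eq]
  exact FiniteDimensional.span_of_finite ℝ (Set.finite_range _)

theorem wickLp_mem_chaos (a b c : E n) : wickLp a b c ∈ chaos n 3 := by
  refine wickLp_mem_of_span span_ee ?_ a b c
  rintro _ ⟨i, rfl⟩ _ ⟨j, rfl⟩ _ ⟨k, rfl⟩
  rw [chaos_three_eq]
  exact Submodule.subset_span ⟨(i, j, k), rfl⟩

theorem zonal_eq {u : E n} (hu : ‖u‖ = 1) : zonal u = Submodule.span ℝ {wickLp u u u} := by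
  rw [zonal]
  congr 1
  have e : (fun x => H 3 (inner ℝ u x)) = wick u u u := by
    funext x
    rw [H_three, wick, real_inner_self_eq_norm_sq, hu]; ring
  rw [e]
  ext φ
  exact ⟨fun h => eq_wickLp h, fun h => by rw [Set.mem_singleton_iff.1 h]; exact coeFn_wickLp _ _ _⟩

/-- Since ⟨u, v⟩ = 0, mixed contractions vanish, and each block generator is a Wick product with u
repeated j times and v repeated k times. -/
theorem block_eq_of {u : E n} {j k : ℕ} {W : E n → E n × E n × E n}
    (hW : ∀ v, ‖v‖ = 1 → inner ℝ u v = 0 → ∀ x,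
      H j (inner ℝ u x) * H k (inner ℝ v x) = wick (W v).1 (W v).2.1 (W v).2.2 x) :
    block u j k = Submodule.span ℝ {φ | ∃ v, ‖v‖ = 1 ∧ inner ℝ u v = 0 ∧
      φ = wickLp (W v).1 (W v).2.1 (W v).2.2} := by
  rw [block]
  congr 1
  ext φ
  constructor
  · rintro ⟨v, h1, h2, h3⟩
    simp_rw [hW v h1 h2] at h3
    exact ⟨v, h1, h2, eq_wickLp h3⟩
  · rintro ⟨v, h1, h2, rfl⟩
    refine ⟨v, h1, h2, ?_⟩
    simp_rw [hW v h1 h2]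
    exact coeFn_wickLp _ _ _

theorem block_one_two {u : E n} :
    block u 1 2 = Submodule.span ℝ {φ | ∃ v, ‖v‖ = 1 ∧ inner ℝ u v = 0 ∧
      φ = wickLp u v v} :=
  block_eq_of (W := fun v => (u, v, v)) fun v h1 h2 x => by
    simp only [wick, H_one, H_two, h2, real_inner_self_eq_norm_sq, h1]; ring

theorem block_two_one {u : E n} (hu : ‖u‖ = 1) :
    block u 2 1 = Submodule.span ℝ {φ | ∃ v, ‖v‖ = 1 ∧ inner ℝ u v = 0 ∧
      φ = wickLp u u v} :=
  block_eq_of (W := fun v => (u, u, v)) fun v h1 h2 x => by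
    simp only [wick, H_one, H_two, h2, real_inner_self_eq_norm_sq, hu]; ring

theorem block_zero_three {u : E n} :
    block u 0 3 = Submodule.span ℝ {φ | ∃ v, ‖v‖ = 1 ∧ inner ℝ u v = 0 ∧
      φ = wickLp v v v} :=
  block_eq_of (W := fun v => (v, v, v)) fun v h1 h2 x => by
    simp only [wick, H_zero, H_three, real_inner_self_eq_norm_sq, h1]; ring

theorem exists_unit_smul {u : E n} {w : E n} (hw : inner ℝ u w = 0) (h0 : w ≠ 0) :
    ∃ v : E n, ‖v‖ = 1 ∧ inner ℝ u v = 0 ∧ w = ‖w‖ • v :=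
  ⟨‖w‖⁻¹ • w, norm_smul_inv_norm h0, by rw [inner_smul_right, hw, mul_zero],
    by rw [smul_smul, mul_inv_cancel₀ (norm_ne_zero_iff.2 h0), one_smul]⟩

/-- By multilinearity it suffices that each argument is u or orthogonal to u. The blocks contain
only the diagonal products in the orthogonal vector, and polarization recovers the mixed ones. -/
theorem wickLp_mem_sup {u : E n} (hu : ‖u‖ = 1) (a b c : E n) :
    wickLp a b c ∈ zonal u ⊔ transverse u := by
  set S := zonal u ⊔ transverse u with hS
  have hz : zonal u ≤ S := le_sup_left
  have h12 : block u 1 2 ≤ S := (le_sup_left.trans le_sup_left).trans le_sup_right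
  have h21 : block u 2 1 ≤ S := (le_sup_right.trans le_sup_left).trans le_sup_right
  have h03 : block u 0 3 ≤ S := le_sup_right.trans le_sup_right
  have z0 : ∀ b c : E n, wickLp 0 b c = 0 := fun b c => (wickLin b c).map_zero
  have c000 : wickLp u u u ∈ S := hz (by rw [zonal_eq hu]; exact Submodule.mem_span_singleton_self _)
  have c1 : ∀ w, inner ℝ u w = 0 → wickLp w u u ∈ S := by
    intro w hw
    rcases eq_or_ne w 0 with rfl | h0
    · rw [z0]; exact S.zero_mem
    obtain ⟨v, hv, huv, e⟩ := exists_unit_smul hw h0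
    rw [e, wickLp_smul]
    refine S.smul_mem _ (h21 ?_)
    rw [block_two_one hu, wickLp_rotate]
    exact Submodule.subset_span ⟨v, hv, huv, rfl⟩
  have c2 : ∀ w, inner ℝ u w = 0 → wickLp w w u ∈ S := by
    intro w hw
    rcases eq_or_ne w 0 with rfl | h0
    · rw [z0]; exact S.zero_mem
    obtain ⟨v, hv, huv, e⟩ := exists_unit_smul hw h0
    rw [e, wickLp_smul, wickLp_swap, wickLp_smul]
    refine S.smul_mem _ (S.smul_mem _ (h12 ?_))
    rw [block_one_two, ← wickLp_rotate]
    exact Submodule.subset_span ⟨v, hv, huv, rfl⟩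
  have c3 : ∀ w, inner ℝ u w = 0 → wickLp w w w ∈ S := by
    intro w hw
    rcases eq_or_ne w 0 with rfl | h0
    · rw [z0]; exact S.zero_mem
    obtain ⟨v, hv, huv, e⟩ := exists_unit_smul hw h0
    rw [e, wickLp_smul, wickLp_rotate, wickLp_smul, wickLp_rotate, wickLp_smul]
    refine S.smul_mem _ (S.smul_mem _ (S.smul_mem _ (h03 ?_)))
    rw [block_zero_three]
    exact Submodule.subset_span ⟨v, hv, huv, rfl⟩
  have add0 : ∀ v w : E n, inner ℝ u v = 0 → inner ℝ u w = 0 → inner ℝ u (v + w) = 0 := by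
    intro v w hv hw; rw [inner_add_right, hv, hw, add_zero]
  have add2 : ∀ a b b' c : E n, wickLp a (b + b') c = wickLp a b c + wickLp a b' c := by
    intro a b b' c
    rw [wickLp_swap, wickLp_add, wickLp_swap b, wickLp_swap b']
  have add3 : ∀ a b c c' : E n, wickLp a b (c + c') = wickLp a b c + wickLp a b c' := by
    intro a b c c'
    rw [← wickLp_rotate, wickLp_add, wickLp_rotate c, wickLp_rotate c']
  have d2 : ∀ v w, inner ℝ u v = 0 → inner ℝ u w = 0 → wickLp v w u ∈ S := by
    intro v w hv hw
    have e : wickLp v w u = (1 / 2 : ℝ) • (wickLp (v + w) (v + w) u - wickLp v v u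
        - wickLp w w u) := by
      rw [wickLp_add, add2, add2, wickLp_swap w v]
      module
    rw [e]
    exact S.smul_mem _ (S.sub_mem (S.sub_mem (c2 _ (add0 v w hv hw)) (c2 v hv)) (c2 w hw))
  have d3' : ∀ v w, inner ℝ u v = 0 → inner ℝ u w = 0 → wickLp v v w ∈ S := by
    intro v w hv hw
    have hw' : inner ℝ u ((-1 : ℝ) • w) = 0 := by rw [inner_smul_right, hw, mul_zero]
    -- Cubic polarization: (v + w)³ - (v - w)³ - 2w³ = 6v²w.
    have e : wickLp v v w = (1 / 6 : ℝ) • (wickLp (v + w) (v + w) (v + w) +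
        (-1 : ℝ) • wickLp (v + (-1 : ℝ) • w) (v + (-1 : ℝ) • w) (v + (-1 : ℝ) • w)
        - (2 : ℝ) • wickLp w w w) := by
      have s2 : ∀ a b c : E n, wickLp a ((-1 : ℝ) • b) c = (-1 : ℝ) • wickLp a b c := by
        intro a b c; rw [wickLp_swap, wickLp_smul, wickLp_swap]
      have s3 : ∀ a b c : E n, wickLp a b ((-1 : ℝ) • c) = (-1 : ℝ) • wickLp a b c := by
        intro a b c; rw [← wickLp_rotate, wickLp_smul, wickLp_rotate]
      simp only [wickLp_add, add2, add3, wickLp_smul, s2, s3]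
      rw [wickLp_swap w v v, ← wickLp_rotate w v v, wickLp_swap w v v, wickLp_swap w v w,
        ← wickLp_rotate w v w, wickLp_swap w v w, ← wickLp_rotate v w w]
      module
    rw [e]
    refine S.smul_mem _ (S.sub_mem (S.add_mem (c3 _ (add0 v w hv hw)) (S.smul_mem _
      (c3 _ (add0 _ _ hv hw')))) (S.smul_mem _ (c3 w hw)))
  have d3 : ∀ a b c, inner ℝ u a = 0 → inner ℝ u b = 0 → inner ℝ u c = 0 → wickLp a b c ∈ S := by
    intro a b c ha hb hc
    have e : wickLp a b c = (1 / 2 : ℝ) • (wickLp (a + b) (a + b) c - wickLp a a c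
        - wickLp b b c) := by
      rw [wickLp_add, add2, add2, wickLp_swap b a]
      module
    rw [e]
    exact S.smul_mem _ (S.sub_mem (S.sub_mem (d3' _ _ (add0 a b ha hb) hc) (d3' a c ha hc))
      (d3' b c hb hc))
  refine wickLp_mem_of_span (s := {u} ∪ {w | inner ℝ u w = 0}) ?_ ?_ a b c
  · rw [eq_top_iff]
    intro x _
    have hx : x = inner ℝ u x • u + perp u x := by rw [perp]; abel
    rw [hx]
    refine Submodule.add_mem _ (Submodule.smul_mem _ _ (Submodule.subset_span (Or.inl rfl)))
      (Submodule.subset_span (Or.inr ?_))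
    show inner ℝ u (perp u x) = 0
    rw [perp, inner_sub_right, inner_smul_right, real_inner_self_eq_norm_sq, hu]; ring
  · rintro a (rfl | ha) b (rfl | hb) c (rfl | hc)
    · exact c000
    · rw [← wickLp_rotate]; exact c1 c hc
    · rw [wickLp_swap]; exact c1 b hb
    · rw [wickLp_rotate]; exact d2 b c hb hc
    · exact c1 a ha
    · rw [← wickLp_rotate]; exact d2 c a hc ha
    · exact d2 a b ha hb
    · exact d3 a b c ha hb hc

theorem block_le_chaos {u : E n} (hu : ‖u‖ = 1) :
    block u 1 2 ≤ chaos n 3 ∧ block u 2 1 ≤ chaos n 3 ∧ block u 0 3 ≤ chaos n 3 := by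
  refine ⟨?_, ?_, ?_⟩
  · rw [block_one_two, Submodule.span_le]
    rintro _ ⟨v, -, -, rfl⟩; exact wickLp_mem_chaos _ _ _
  · rw [block_two_one hu, Submodule.span_le]
    rintro _ ⟨v, -, -, rfl⟩; exact wickLp_mem_chaos _ _ _
  · rw [block_zero_three, Submodule.span_le]
    rintro _ ⟨v, -, -, rfl⟩; exact wickLp_mem_chaos _ _ _

theorem chaos_three_eq_sup {u : E n} (hu : ‖u‖ = 1) : chaos n 3 = zonal u ⊔ transverse u := by
  apply le_antisymm
  · rw [chaos_three_eq, Submodule.span_le]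
    rintro _ ⟨t, rfl⟩
    exact wickLp_mem_sup hu _ _ _
  · obtain ⟨h1, h2, h3⟩ := block_le_chaos hu
    refine sup_le ?_ (sup_le (sup_le h1 h2) h3)
    rw [zonal_eq hu, Submodule.span_le, Set.singleton_subset_iff]
    exact wickLp_mem_chaos _ _ _

/-! ### Gaussian moments and orthogonality of Hermite polynomials -/

/-- Integrate the derivative of z^{k+1}γ(z), which vanishes at both ends. -/
theorem integral_pow_succ_succ (k : ℕ) :
    ∫ z, z ^ (k + 2) ∂gaussianReal 0 1 = (k + 1) * ∫ z, z ^ k ∂gaussianReal 0 1 := by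
  rw [integral_gaussian', integral_gaussian', ← integral_const_mul]
  have hi : Integrable fun z : ℝ => (k + 1) * (z ^ k * gd z) - z ^ (k + 2) * gd z :=
    ((integrable_pow_mul_gd k).const_mul _).sub (integrable_pow_mul_gd _)
  have hb : Tendsto (fun z : ℝ => z ^ (k + 1) * gd z) atBot (𝓝 0) := by
    have h := ((tendsto_gd_atTop (k + 1)).comp tendsto_neg_atBot_atTop).const_mul ((-1) ^ (k + 1))
    rw [mul_zero] at h
    refine h.congr fun z => ?_
    simp only [Function.comp, gd_neg]
    rw [← mul_assoc, ← mul_pow]; simp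
  have h := integral_of_hasDerivAt_of_tendsto (f := fun z : ℝ => z ^ (k + 1) * gd z)
    (f' := fun z => (k + 1) * (z ^ k * gd z) - z ^ (k + 2) * gd z)
    (fun z => ((hasDerivAt_pow (k + 1) z).mul (hasDerivAt_gd z)).congr_deriv (by
      simp; ring)) hi hb (tendsto_gd_atTop (k + 1))
  rw [integral_sub ((integrable_pow_mul_gd k).const_mul _) (integrable_pow_mul_gd _)] at h
  linarith

theorem integral_pow_zero : ∫ z : ℝ, z ^ 0 ∂gaussianReal 0 1 = 1 := by simp

theorem integral_pow_one : ∫ z : ℝ, z ^ 1 ∂gaussianReal 0 1 = 0 := by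
  simp [integral_id_gaussianReal]

theorem integral_pow_two : ∫ z : ℝ, z ^ 2 ∂gaussianReal 0 1 = 1 := by
  have := integral_pow_succ_succ 0
  rw [integral_pow_zero] at this; simpa using this

theorem integral_pow_three : ∫ z : ℝ, z ^ 3 ∂gaussianReal 0 1 = 0 := by
  have := integral_pow_succ_succ 1
  rw [integral_pow_one] at this; simpa using this

theorem integral_pow_four : ∫ z : ℝ, z ^ 4 ∂gaussianReal 0 1 = 3 := by
  have := integral_pow_succ_succ 2
  rw [integral_pow_two] at this; norm_num at this; exact this

theorem integral_pow_five : ∫ z : ℝ, z ^ 5 ∂gaussianReal 0 1 = 0 := by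
  have := integral_pow_succ_succ 3
  rw [integral_pow_three] at this; simpa using this

theorem integral_pow_six : ∫ z : ℝ, z ^ 6 ∂gaussianReal 0 1 = 15 := by
  have := integral_pow_succ_succ 4
  rw [integral_pow_four] at this; norm_num at this; exact this

theorem integral_poly_gaussian (c₀ c₁ c₂ c₃ c₄ c₅ c₆ : ℝ) :
    ∫ z, (c₀ * z ^ 0 + c₁ * z ^ 1 + c₂ * z ^ 2 + c₃ * z ^ 3 + c₄ * z ^ 4 + c₅ * z ^ 5 + c₆ * z ^ 6)
      ∂gaussianReal 0 1 = c₀ + c₂ + 3 * c₄ + 15 * c₆ := by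
  have step : ∀ (f : ℝ → ℝ) (c : ℝ) (k : ℕ), Integrable f (gaussianReal 0 1) →
      Integrable (fun z => f z + c * z ^ k) (gaussianReal 0 1) ∧
      ∫ z, (f z + c * z ^ k) ∂gaussianReal 0 1 =
        ∫ z, f z ∂gaussianReal 0 1 + c * ∫ z, z ^ k ∂gaussianReal 0 1 := fun f c k hf => by
    have hk := (integrable_pow_gaussian k).const_mul c
    exact ⟨hf.add hk, by rw [integral_add hf hk, integral_const_mul]⟩
  have h0 := (integrable_pow_gaussian 0).const_mul c₀
  obtain ⟨h1, e1⟩ := step _ c₁ 1 h0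
  obtain ⟨h2, e2⟩ := step _ c₂ 2 h1
  obtain ⟨h3, e3⟩ := step _ c₃ 3 h2
  obtain ⟨h4, e4⟩ := step _ c₄ 4 h3
  obtain ⟨h5, e5⟩ := step _ c₅ 5 h4
  obtain ⟨h6, e6⟩ := step _ c₆ 6 h5
  rw [e6, e5, e4, e3, e2, e1, integral_const_mul, integral_pow_zero, integral_pow_one,
    integral_pow_two, integral_pow_three, integral_pow_four, integral_pow_five, integral_pow_six]
  ring

/-- The Gaussian integral of the product of two Hermite polynomials of degree at most three. -/
theorem integral_H_mul_H {j k : ℕ} (hj : j ≤ 3) (hk : k ≤ 3) :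
    ∫ z, H j z * H k z ∂gaussianReal 0 1 = if j = k then (j.factorial : ℝ) else 0 := by
  have key : ∀ c₀ c₁ c₂ c₃ c₄ c₅ c₆ : ℝ, (∀ z, H j z * H k z = c₀ * z ^ 0 + c₁ * z ^ 1 + c₂ * z ^ 2
      + c₃ * z ^ 3 + c₄ * z ^ 4 + c₅ * z ^ 5 + c₆ * z ^ 6) →
      ∫ z, H j z * H k z ∂gaussianReal 0 1 = c₀ + c₂ + 3 * c₄ + 15 * c₆ := by
    intro c₀ c₁ c₂ c₃ c₄ c₅ c₆ h
    simp_rw [h]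
    exact integral_poly_gaussian c₀ c₁ c₂ c₃ c₄ c₅ c₆
  interval_cases j <;> interval_cases k
  · rw [key 1 0 0 0 0 0 0 fun z => by simp [H_zero]]; simp
  · rw [key 0 1 0 0 0 0 0 fun z => by simp [H_zero, H_one]]; simp
  · rw [key (-1) 0 1 0 0 0 0 fun z => by simp [H_zero, H_two]; ring]; simp
  · rw [key 0 (-3) 0 1 0 0 0 fun z => by simp [H_zero, H_three]; ring]; simp
  · rw [key 0 1 0 0 0 0 0 fun z => by simp [H_zero, H_one]]; simp
  · rw [key 0 0 1 0 0 0 0 fun z => by simp [H_one]; ring]; simp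
  · rw [key 0 (-1) 0 1 0 0 0 fun z => by simp [H_one, H_two]; ring]; simp
  · rw [key 0 0 (-3) 0 1 0 0 fun z => by simp [H_one, H_three]; ring]; simp
  · rw [key (-1) 0 1 0 0 0 0 fun z => by simp [H_zero, H_two]; ring]; simp
  · rw [key 0 (-1) 0 1 0 0 0 fun z => by simp [H_one, H_two]; ring]; simp
  · rw [key 1 0 (-2) 0 1 0 0 fun z => by simp [H_two]; ring]; norm_num
  · rw [key 0 3 0 (-4) 0 1 0 fun z => by simp [H_two, H_three]; ring]; simp
  · rw [key 0 (-3) 0 1 0 0 0 fun z => by simp [H_zero, H_three]; ring]; simp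
  · rw [key 0 0 (-3) 0 1 0 0 fun z => by simp [H_one, H_three]; ring]; simp
  · rw [key 0 3 0 (-4) 0 1 0 fun z => by simp [H_two, H_three]; ring]; simp
  · rw [key 0 0 9 0 (-6) 0 1 fun z => by simp [H_three]; ring]; norm_num [Nat.factorial]

theorem integral_H {k : ℕ} (h1 : 1 ≤ k) (hk : k ≤ 3) : ∫ z, H k z ∂gaussianReal 0 1 = 0 := by
  have h := integral_H_mul_H (j := 0) (by omega) hk
  simp only [H_zero, one_mul] at h
  rw [h, if_neg (by omega)]

theorem measurable_H (k : ℕ) : Measurable (H k) := by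
  unfold H
  exact (Polynomial.continuous_aeval _).measurable

theorem AllLp.H {f : E n → ℝ} (hf : AllLp f) (k : ℕ) : AllLp fun x => ReedsOperator.H k (f x) := by
  unfold ReedsOperator.H
  have key : ∀ P : Polynomial ℤ, AllLp fun x => Polynomial.aeval (f x) P := by
    intro P
    induction P using Polynomial.induction_on' with
    | add P Q hP hQ => simpa using hP.add hQ
    | monomial k c => simpa [Polynomial.aeval_monomial] using (hf.pow k).const_mul c
  exact key _

/-! ### Elements of the blocks -/

/-- The span of the functions `H_k(⟨v, x⟩)` with `v` a unit vector orthogonal to `u`. -/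
def perpSpan (u : E n) (k : ℕ) : Submodule ℝ (E n → ℝ) :=
  Submodule.span ℝ {q | ∃ v : E n, ‖v‖ = 1 ∧ inner ℝ u v = 0 ∧ q = fun x => H k (inner ℝ v x)}

/-- The factor H_j(Z) is common to all generators, so a linear combination is still a single
product, to which independence of Z and Y applies. -/
theorem exists_of_mem_block {u : E n} {j k : ℕ} {φ : Lp ℝ 2 (gam n)} (h : φ ∈ block u j k) :
    ∃ q ∈ perpSpan u k, φ =ᵐ[gam n] fun x => H j (inner ℝ u x) * q x := by
  rw [block] at h
  induction h using Submodule.span_induction with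
  | mem φ h =>
    obtain ⟨v, h1, h2, h3⟩ := h
    exact ⟨_, Submodule.subset_span ⟨v, h1, h2, rfl⟩, h3⟩
  | zero =>
    refine ⟨0, Submodule.zero_mem _, (Lp.coeFn_zero _ _ _).trans (Eventually.of_forall fun x => ?_)⟩
    simp
  | add φ ψ _ _ hφ hψ =>
    obtain ⟨q, hq, e⟩ := hφ
    obtain ⟨r, hr, e'⟩ := hψ
    refine ⟨q + r, Submodule.add_mem _ hq hr, (Lp.coeFn_add _ _).trans ?_⟩
    filter_upwards [e, e'] with x h1 h2
    simp only [Pi.add_apply, h1, h2]; ring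
  | smul c φ _ hφ =>
    obtain ⟨q, hq, e⟩ := hφ
    refine ⟨c • q, Submodule.smul_mem _ c hq, (Lp.coeFn_smul _ _).trans ?_⟩
    filter_upwards [e] with x h1
    simp only [Pi.smul_apply, h1, smul_eq_mul]; ring

theorem perpSpan_spec {u : E n} {k : ℕ} {q : E n → ℝ} (h : q ∈ perpSpan u k) :
    Measurable q ∧ AllLp q ∧ ∀ x, q (perp u x) = q x := by
  induction h using Submodule.span_induction with
  | mem q h =>
    obtain ⟨v, h1, h2, rfl⟩ := h
    refine ⟨(measurable_H k).comp (by fun_prop), (AllLp.inner v).H k, fun x => ?_⟩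
    simp only [inner_perp h2]
  | zero => exact ⟨measurable_const, AllLp.const 0, fun _ => rfl⟩
  | add q r _ _ hq hr =>
    exact ⟨hq.1.add hr.1, hq.2.1.add hr.2.1, fun x => by simp [hq.2.2, hr.2.2]⟩
  | smul c q _ hq =>
    exact ⟨hq.1.const_smul c, hq.2.1.const_mul c, fun x => by simp [hq.2.2]⟩

theorem perpSpan_integral {u : E n} {k : ℕ} (h1 : 1 ≤ k) (h3 : k ≤ 3) {q : E n → ℝ}
    (h : q ∈ perpSpan u k) : ∫ x, q x ∂gam n = 0 := by
  induction h using Submodule.span_induction with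
  | mem q h =>
    obtain ⟨v, hv, -, rfl⟩ := h
    rw [integral_comp_inner hv (measurable_H k), integral_H h1 h3]
  | zero => simp
  | add q r hq' hr' hq hr =>
    simp only [Pi.add_apply]
    rw [integral_add (perpSpan_spec hq').2.1.integrable (perpSpan_spec hr').2.1.integrable, hq, hr,
      add_zero]
  | smul c q _ hq => simp only [Pi.smul_apply, smul_eq_mul, integral_const_mul, hq, mul_zero]

/-- In degree one the transverse factor is a linear form, so the first-moment condition on g applies
to it. -/
theorem perpSpan_one {u : E n} {q : E n → ℝ} (h : q ∈ perpSpan u 1) :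
    ∃ w : E n, inner ℝ u w = 0 ∧ q = fun x => inner ℝ w x := by
  induction h using Submodule.span_induction with
  | mem q h =>
    obtain ⟨v, -, h2, rfl⟩ := h
    exact ⟨v, h2, by simp [H_one]⟩
  | zero => exact ⟨0, by simp, by funext x; simp⟩
  | add q r _ _ hq hr =>
    obtain ⟨v, h1, rfl⟩ := hq
    obtain ⟨w, h2, rfl⟩ := hr
    exact ⟨v + w, by rw [inner_add_right, h1, h2, add_zero], by
      funext x; simp [inner_add_left]⟩
  | smul c q _ hq =>
    obtain ⟨v, h1, rfl⟩ := hq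
    exact ⟨c • v, by rw [inner_smul_right, h1, mul_zero], by
      funext x; simp [inner_smul_left]⟩

/-- Factorization of expectations for functions of the orthogonal component. -/
theorem integral_mul_of_perp {u : E n} (hu : ‖u‖ = 1) {F : ℝ → ℝ} (hF : Measurable F)
    {q : E n → ℝ} (hq : Measurable q) (hp : ∀ x, q (perp u x) = q x) :
    ∫ x, F (inner ℝ u x) * q x ∂gam n = (∫ z, F z ∂gaussianReal 0 1) * ∫ x, q x ∂gam n := by
  have := integral_mul_perp hu hF hq
  simpa only [hp] using this

theorem inner_eq_integral {φ ψ : Lp ℝ 2 (gam n)} {f g : E n → ℝ} (hf : φ =ᵐ[gam n] f)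
    (hg : ψ =ᵐ[gam n] g) : inner ℝ φ ψ = ∫ x, f x * g x ∂gam n := by
  rw [L2.inner_def]
  refine integral_congr_ae ?_
  filter_upwards [hf, hg] with x h1 h2
  rw [h1, h2]; simp [mul_comm]

/-- After factorization the Z-integral vanishes because the degrees in Z differ. -/
theorem inner_block_block {u : E n} (hu : ‖u‖ = 1) {i j k l : ℕ} (hi : i ≤ 3) (hj : j ≤ 3)
    (hij : i ≠ j) : ∀ φ ∈ block u i k, ∀ ψ ∈ block u j l, inner ℝ φ ψ = 0 := by
  intro φ hφ ψ hψ
  obtain ⟨q, hq, e⟩ := exists_of_mem_block hφ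
  obtain ⟨r, hr, e'⟩ := exists_of_mem_block hψ
  obtain ⟨q1, -, q3⟩ := perpSpan_spec hq
  obtain ⟨r1, -, r3⟩ := perpSpan_spec hr
  rw [inner_eq_integral e e']
  have : ∀ x, H i (inner ℝ u x) * q x * (H j (inner ℝ u x) * r x) =
      H i (inner ℝ u x) * H j (inner ℝ u x) * (q x * r x) := fun x => by ring
  simp_rw [this]
  rw [integral_mul_of_perp hu (F := fun z => H i z * H j z)
    ((measurable_H i).mul (measurable_H j)) (q := fun x => q x * r x) (q1.mul r1)
    (fun x => by rw [q3, r3]),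
    integral_H_mul_H hi hj, if_neg hij, zero_mul]

/-- Functions of `Z` are orthogonal to the blocks. -/
theorem integral_mul_block {u : E n} (hu : ‖u‖ = 1) {j k : ℕ} (hk : 1 ≤ k) (hk' : k ≤ 3)
    {F : ℝ → ℝ} (hF : Measurable F) {φ : Lp ℝ 2 (gam n)} (hφ : φ ∈ block u j k) :
    ∫ x, F (inner ℝ u x) * φ x ∂gam n = 0 := by
  obtain ⟨q, hq, e⟩ := exists_of_mem_block hφ
  obtain ⟨q1, -, q3⟩ := perpSpan_spec hq
  have h : ∫ x, F (inner ℝ u x) * φ x ∂gam n =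
      ∫ x, F (inner ℝ u x) * H j (inner ℝ u x) * q x ∂gam n := by
    refine integral_congr_ae ?_
    filter_upwards [e] with x hx
    rw [hx]; ring
  rw [h, integral_mul_of_perp hu (F := fun z => F z * H j z) (hF.mul (measurable_H j)) q1 q3,
    perpSpan_integral hk hk' hq, mul_zero]

theorem integrable_mul_Lp {f : E n → ℝ} (hf : MemLp f 2 (gam n)) (φ : Lp ℝ 2 (gam n)) :
    Integrable (fun x => f x * φ x) (gam n) :=
  MemLp.integrable_mul hf (Lp.memLp φ)

theorem integral_mul_transverse {u : E n} (hu : ‖u‖ = 1) {F : ℝ → ℝ} (hF : Measurable F)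
    (hF2 : MemLp (fun x => F (inner ℝ u x)) 2 (gam n))
    {φ : Lp ℝ 2 (gam n)} (hφ : φ ∈ transverse u) :
    ∫ x, F (inner ℝ u x) * φ x ∂gam n = 0 := by
  obtain ⟨ψ, hψ, c, hc, rfl⟩ := Submodule.mem_sup.1 hφ
  obtain ⟨a, ha, b, hb, rfl⟩ := Submodule.mem_sup.1 hψ
  have h : ∫ x, F (inner ℝ u x) * (a + b + c : Lp ℝ 2 (gam n)) x ∂gam n =
      ∫ x, (F (inner ℝ u x) * a x + F (inner ℝ u x) * b x + F (inner ℝ u x) * c x) ∂gam n := by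
    refine integral_congr_ae ?_
    filter_upwards [Lp.coeFn_add (a + b) c, Lp.coeFn_add a b] with x h1 h2
    rw [h1, Pi.add_apply, h2, Pi.add_apply]; ring
  have ia := integrable_mul_Lp hF2 a
  have ib := integrable_mul_Lp hF2 b
  rw [h, integral_add (f := fun x => F (inner ℝ u x) * a x + F (inner ℝ u x) * b x)
      (ia.add ib) (integrable_mul_Lp hF2 c), integral_add ia ib,
    integral_mul_block hu (by norm_num) (by norm_num) hF ha,
    integral_mul_block hu (by norm_num) (by norm_num) hF hb,
    integral_mul_block hu (by norm_num) (by norm_num) hF hc]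
  simp

theorem memLp_H_inner (u : E n) (k : ℕ) : MemLp (fun x => H k (inner ℝ u x)) 2 (gam n) :=
  ((AllLp.inner u).H k).memLp_two

theorem coeFn_wickLp_self {u : E n} (hu : ‖u‖ = 1) :
    ⇑(wickLp u u u) =ᵐ[gam n] fun x => H 3 (inner ℝ u x) := by
  refine (coeFn_wickLp u u u).trans (Eventually.of_forall fun x => ?_)
  simp only [wick, H_three, real_inner_self_eq_norm_sq, hu]; ring

theorem finiteDimensional_blocks {u : E n} (hu : ‖u‖ = 1) :
    FiniteDimensional ℝ (block u 1 2) ∧ FiniteDimensional ℝ (block u 2 1) ∧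
      FiniteDimensional ℝ (block u 0 3) ∧ FiniteDimensional ℝ (zonal u) := by
  obtain ⟨h1, h2, h3⟩ := block_le_chaos hu
  refine ⟨Submodule.finiteDimensional_of_le h1, Submodule.finiteDimensional_of_le h2,
    Submodule.finiteDimensional_of_le h3, ?_⟩
  rw [zonal_eq hu]; infer_instance

theorem inner_zonal_transverse {u : E n} (hu : ‖u‖ = 1) :
    ∀ φ ∈ zonal u, ∀ ψ ∈ transverse u, inner ℝ φ ψ = 0 := by
  intro φ hφ ψ hψ
  rw [zonal_eq hu] at hφ
  obtain ⟨c, rfl⟩ := Submodule.mem_span_singleton.1 hφ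
  rw [inner_smul_left, inner_eq_integral (coeFn_wickLp_self hu) (ae_eq_refl _),
    integral_mul_transverse hu (measurable_H 3) (memLp_H_inner u 3) hψ]
  simp

theorem projLp_chaos {u : E n} (hu : ‖u‖ = 1) (f : Lp ℝ 2 (gam n)) :
    projLp (chaos n 3) f = projLp (zonal u) f + projLp (transverse u) f := by
  obtain ⟨h1, h2, h3, h4⟩ := finiteDimensional_blocks hu
  have h5 : FiniteDimensional ℝ (transverse u) := by unfold transverse; infer_instance
  rw [chaos_three_eq_sup hu, projLp_sup (inner_zonal_transverse hu)]

theorem projLp_transverse {u : E n} (hu : ‖u‖ = 1) (f : Lp ℝ 2 (gam n)) :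
    projLp (transverse u) f =
      projLp (block u 1 2) f + projLp (block u 2 1) f + projLp (block u 0 3) f := by
  obtain ⟨h1, h2, h3, h4⟩ := finiteDimensional_blocks hu
  rw [transverse, projLp_sup, projLp_sup]
  · exact inner_block_block hu (by norm_num) (by norm_num) (by norm_num)
  · intro φ hφ ψ hψ
    obtain ⟨a, ha, b, hb, rfl⟩ := Submodule.mem_sup.1 hφ
    rw [inner_add_left,
      inner_block_block hu (by norm_num) (by norm_num) (by norm_num) a ha ψ hψ,
      inner_block_block hu (by norm_num) (by norm_num) (by norm_num) b hb ψ hψ, add_zero]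

/-- The factor 1/6 is 1/‖H₃‖² = 1/3!. -/
theorem projLp_zonal {u : E n} (hu : ‖u‖ = 1) {g : E n → ℝ} (hg : MemLp g 2 (gam n)) :
    projLp (zonal u) (hg.toLp g) =
      (1 / 6 * ∫ x, g x * H 3 (inner ℝ u x) ∂gam n) • wickLp u u u := by
  obtain ⟨-, -, -, h4⟩ := finiteDimensional_blocks hu
  refine projLp_unique ?_ fun w hw => ?_
  · rw [zonal_eq hu]; exact Submodule.smul_mem _ _ (Submodule.mem_span_singleton_self _)
  · rw [zonal_eq hu] at hw
    obtain ⟨c, rfl⟩ := Submodule.mem_span_singleton.1 hw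
    rw [inner_smul_right, inner_sub_left, inner_smul_left,
      inner_eq_integral hg.coeFn_toLp (coeFn_wickLp_self hu),
      inner_eq_integral (coeFn_wickLp_self hu) (coeFn_wickLp_self hu),
      integral_comp_inner hu (F := fun z => H 3 z * H 3 z)
        ((measurable_H 3).mul (measurable_H 3)), integral_H_mul_H le_rfl le_rfl]
    simp [Nat.factorial]
    right; ring

/-! ### Slab and outer parts of a maximizer and of its sign -/

/-- The function `sign z` on `|z| ≥ η`, extended by zero. -/
def outer (η z : ℝ) : ℝ := if |z| < η then 0 else Real.sign z

theorem measurable_outer (η : ℝ) : Measurable (outer η) :=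
  Measurable.ite (measurableSet_abs_lt η) measurable_const measurable_sign

theorem abs_outer_le (η z : ℝ) : |outer η z| ≤ 1 := by
  unfold outer; split_ifs
  · simp
  · exact abs_sign_le z

/-- The restriction of `g` to the slab `|⟨u, x⟩| < η`. -/
def slab (η : ℝ) (u : E n) (g : E n → ℝ) (x : E n) : ℝ := if |inner ℝ u x| < η then g x else 0

theorem measurable_slab (η : ℝ) (u : E n) {g : E n → ℝ} (hg : Measurable g) :
    Measurable (slab η u g) :=
  Measurable.ite (measurableSet_lt (by fun_prop) measurable_const) hg measurable_const

theorem abs_slab_le {η : ℝ} {u : E n} {g : E n → ℝ} (hg : ∀ x, |g x| ≤ 1) (x : E n) :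
    |slab η u g x| ≤ 1 := by
  unfold slab; split_ifs
  · exact hg x
  · simp

theorem allLp_outer_mul (η : ℝ) (u : E n) {f : E n → ℝ} (hf : AllLp f) :
    AllLp fun x => outer η (inner ℝ u x) * f x :=
  AllLp.bdd_mul ((measurable_outer η).comp (by fun_prop)) (fun _ => abs_outer_le _ _) hf

theorem allLp_slab_mul (η : ℝ) (u : E n) {g f : E n → ℝ} (hg : g ∈ unitFunctions n)
    (hf : AllLp f) : AllLp fun x => slab η u g x * f x :=
  AllLp.bdd_mul (measurable_slab η u hg.1) (abs_slab_le hg.2) hf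

theorem integral_outer_mul_id {η : ℝ} (hη : 0 < η) :
    ∫ z, outer η z * z ∂gaussianReal 0 1 = alphaOf η := by
  have hs := measurableSet_abs_lt η
  have hi : Integrable (fun z : ℝ => z) (gaussianReal 0 1) := by
    simpa using integrable_pow_gaussian 1
  have e : ∀ z, outer η z * z = extremal η z * z - {z : ℝ | |z| < η}.indicator (fun z => z) z := by
    intro z
    by_cases h : |z| < η <;> simp [outer, extremal, h]
  simp_rw [e]
  rw [integral_sub _ (hi.indicator hs), integral_extremal hη, integral_indicator hs,
    setIntegral_id_gaussian hη, sub_zero]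
  refine hi.mono ((measurable_extremal η).mul measurable_id).aestronglyMeasurable
    (Eventually.of_forall fun z => ?_)
  rw [norm_mul]
  exact mul_le_of_le_one_left (norm_nonneg _) (abs_extremal_le η z)

/-- The integrand is even, so both tails contribute equally. -/
theorem integral_outer_mul_H {η : ℝ} (hη : 0 < η) :
    ∫ z, outer η z * H 3 z ∂gaussianReal 0 1 = B η := by
  rw [integral_gaussian']
  let F : ℝ → ℝ := fun w => if w < η then 0 else (w ^ 3 - 3 * w) * gd w
  have h1 : ∀ z : ℝ, outer η z * H 3 z * gd z = F |z| := by
    intro z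
    simp only [F, outer, H_three]
    split_ifs with h
    · ring
    · rcases lt_trichotomy z 0 with h | h | h
      · rw [Real.sign_of_neg h, abs_of_neg h, gd_neg]; ring
      · simp [h]
      · rw [Real.sign_of_pos h, abs_of_pos h]; ring
  simp_rw [h1]
  rw [integral_comp_abs (f := F), B,
    ← integral_Ici_eq_integral_Ioi (f := fun z => (z ^ 3 - 3 * z) * gd z),
    ← integral_indicator measurableSet_Ioi, ← integral_indicator measurableSet_Ici]
  congr 2; funext w
  by_cases hw : w < η
  · rw [Set.indicator_of_notMem (show w ∉ Set.Ici η by simpa using hw)]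
    simp [Set.indicator_apply, F, hw]
  · rw [Set.indicator_of_mem (show w ∈ Set.Ici η by simpa using hw),
      Set.indicator_of_mem (show w ∈ Set.Ioi 0 from hη.trans_le (not_lt.1 hw))]
    simp [F, hw]

theorem ae_abs_inner_ne {u : E n} (hu : ‖u‖ = 1) (η : ℝ) :
    ∀ᵐ x ∂gam n, |inner ℝ u x| ≠ η := by
  have : NullSingletonClass (gaussianReal 0 1) := nullSingletonClass_gaussianReal one_ne_zero
  have h : ∀ᵐ z ∂gaussianReal 0 1, |z| ≠ η := by
    have h0 : (gaussianReal 0 1) ({η, -η} : Set ℝ) = 0 := (Set.toFinite _).measure_zero _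
    filter_upwards [compl_mem_ae_iff.2 h0] with z hz hc
    apply hz
    rcases eq_or_eq_neg_of_abs_eq hc with h | h <;> simp [h]
  exact (measurePreserving_inner hu).quasiMeasurePreserving.ae h

theorem ae_eq_slab_add_outer {η : ℝ} {u : E n} (hu : ‖u‖ = 1) {g : E n → ℝ}
    (hout : ∀ᵐ x ∂gam n, η < |inner ℝ u x| → g x = Real.sign (inner ℝ u x)) :
    g =ᵐ[gam n] fun x => slab η u g x + outer η (inner ℝ u x) := by
  filter_upwards [hout, ae_abs_inner_ne hu η] with x h1 h2
  rcases lt_or_gt_of_ne h2 with h | h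
  · simp [slab, outer, h]
  · simp [slab, outer, h.not_gt, h1 h]

/-- The value of `sign (R_lam g)` for a `{±1}`-valued function with the structure of a maximizer. -/
theorem ae_signR_eq {η : ℝ} (hη : 0 < η) {g : E n → ℝ} (hg : g ∈ unitFunctions n)
    (hpm : ∀ x, g x = 1 ∨ g x = -1) (hu : ‖dir g‖ = 1) (hm : firstMoment g = alphaOf η • dir g)
    (hout : ∀ᵐ x ∂gam n, η < |inner ℝ (dir g) x| → g x = Real.sign (inner ℝ (dir g) x)) :
    signR (lamOf η) g =ᵐ[gam n]
      fun x => -slab η (dir g) g x + outer η (inner ℝ (dir g) x) := by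
  filter_upwards [hout, ae_abs_inner_ne hu η] with x h1 h2
  have ha := alphaOf_pos hη
  rw [signR, R, P1_eq hg, hm, inner_smul_left, ← alphaOf_mul hη]
  simp only [conj_trivial, slab, outer]
  have hx := hpm x
  generalize (inner ℝ (dir g) x : ℝ) = z at *
  generalize alphaOf η = a at *
  rw [mul_assoc, ← mul_sub]
  rcases lt_or_gt_of_ne h2 with h | h
  -- In the slab |αz| < αη = λ, so the term -λg decides the sign.
  · rw [if_pos h, if_pos h, add_zero]
    obtain ⟨h3, h4⟩ := abs_lt.1 h
    rcases hx with hx | hx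
    · rw [hx, Real.sign_of_neg (by nlinarith)]
    · rw [hx, Real.sign_of_pos (by nlinarith)]; ring
  · rw [if_neg h.not_gt, if_neg h.not_gt, h1 h, neg_zero, zero_add]
    rcases lt_trichotomy z 0 with h3 | h3 | h3
    · rw [abs_of_neg h3] at h
      rw [Real.sign_of_neg h3, Real.sign_of_neg (by nlinarith)]
    · rw [h3, abs_zero] at h; linarith
    · rw [abs_of_pos h3] at h
      rw [Real.sign_of_pos h3, Real.sign_of_pos (by nlinarith)]

theorem integral_slab_mul {η : ℝ} {u : E n} (hu : ‖u‖ = 1) {g : E n → ℝ}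
    (hg : g ∈ unitFunctions n)
    (hout : ∀ᵐ x ∂gam n, η < |inner ℝ u x| → g x = Real.sign (inner ℝ u x))
    {f : E n → ℝ} (hf : AllLp f) :
    ∫ x, slab η u g x * f x ∂gam n =
      ∫ x, g x * f x ∂gam n - ∫ x, outer η (inner ℝ u x) * f x ∂gam n := by
  have h : ∫ x, g x * f x ∂gam n =
      ∫ x, (slab η u g x * f x + outer η (inner ℝ u x) * f x) ∂gam n := by
    refine integral_congr_ae ?_
    filter_upwards [ae_eq_slab_add_outer hu hout] with x hx
    rw [← add_mul, ← hx]
  rw [h, integral_add (allLp_slab_mul η u hg hf).integrable (allLp_outer_mul η u hf).integrable]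
  ring

theorem abs_integral_slab_mul_le {η : ℝ} {u : E n} {g : E n → ℝ}
    (hg : g ∈ unitFunctions n) {f h : E n → ℝ} (hh : AllLp h)
    (hle : ∀ x, |inner ℝ u x| < η → |f x| ≤ h x) :
    |∫ x, slab η u g x * f x ∂gam n| ≤ ∫ x, slab η u (fun _ => 1) x * h x ∂gam n := by
  refine abs_integral_le_integral_abs.trans (integral_mono_of_nonneg
    (Eventually.of_forall fun x => abs_nonneg _)
    (allLp_slab_mul η u ⟨measurable_const, fun x => by simp⟩ hh).integrable
    (Eventually.of_forall fun x => ?_))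
  simp only [slab]
  split_ifs with hx
  · rw [abs_mul]
    exact mul_le_mul (hg.2 x) (hle x hx) (abs_nonneg _) zero_le_one
  · simp

theorem integral_slab_one_mul {η : ℝ} {u : E n} (hu : ‖u‖ = 1) {F : ℝ → ℝ} (hF : Measurable F)
    {q : E n → ℝ} (hq : Measurable q) (hp : ∀ x, q (perp u x) = q x) :
    ∫ x, slab η u (fun _ => 1) x * (F (inner ℝ u x) * q x) ∂gam n =
      (∫ z in {z : ℝ | |z| < η}, F z ∂gaussianReal 0 1) * ∫ x, q x ∂gam n := by
  have hs := measurableSet_abs_lt η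
  rw [← integral_indicator hs, ← integral_mul_of_perp hu (hF.indicator hs) hq hp]
  congr 1; funext x
  by_cases h : |inner ℝ u x| < η <;> simp [slab, Set.indicator, h]

/-! ### The pairing with the third chaos: zonal and transverse parts -/

/-- The structure of a maximizer, as used in the pairing bound. -/
structure MaxStructure (η : ℝ) (g : E n → ℝ) : Prop where
  pos : 0 < η
  mem : g ∈ unitFunctions n
  pm : ∀ x, g x = 1 ∨ g x = -1
  norm_eq : ‖firstMoment g‖ = alphaOf η
  outside : ∀ᵐ x ∂gam n, η < |inner ℝ (dir g) x| → g x = Real.sign (inner ℝ (dir g) x)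

namespace MaxStructure

variable {η : ℝ} {g : E n → ℝ}

theorem norm_dir (s : MaxStructure η g) : ‖dir g‖ = 1 := by
  apply norm_smul_inv_norm
  intro h
  have := alphaOf_pos s.pos
  rw [← s.norm_eq, h, norm_zero] at this
  exact lt_irrefl _ this

theorem firstMoment_eq (s : MaxStructure η g) : firstMoment g = alphaOf η • dir g := by
  rw [dir, s.norm_eq, smul_smul, mul_inv_cancel₀ (alphaOf_pos s.pos).ne', one_smul]

theorem memLp (s : MaxStructure η g) : MemLp g 2 (gam n) := by
  simpa using (AllLp.bdd_mul s.mem.1 s.mem.2 (AllLp.const 1)).memLp_two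

theorem signR_eq (s : MaxStructure η g) : signR (lamOf η) g =ᵐ[gam n]
      fun x => -slab η (dir g) g x + outer η (inner ℝ (dir g) x) :=
  ae_signR_eq s.pos s.mem s.pm s.norm_dir s.firstMoment_eq s.outside

theorem signR_pm (s : MaxStructure η g) :
    ∀ᵐ x ∂gam n, signR (lamOf η) g x = 1 ∨ signR (lamOf η) g x = -1 := by
  filter_upwards [s.signR_eq] with x hx
  rw [hx, slab, outer]
  split_ifs with h
  · rcases s.pm x with h | h <;> simp [h]
  · have h0 : inner ℝ (dir g) x ≠ 0 := by
      rintro h0; rw [h0, abs_zero] at h; exact h s.pos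
    rcases Real.sign_apply_eq_of_ne_zero _ h0 with h | h <;> simp [h]

theorem integral_P1_sq (s : MaxStructure η g) : ∫ x, P1 g x ^ 2 ∂gam n = alphaOf η ^ 2 := by
  simp_rw [P1_eq s.mem, sq]
  rw [integral_inner_mul_inner, real_inner_self_eq_norm_sq, s.norm_eq, sq]

theorem P1_eq' (s : MaxStructure η g) (x : E n) : P1 g x = alphaOf η * inner ℝ (dir g) x := by
  rw [P1_eq s.mem, s.firstMoment_eq, inner_smul_left]; simp

/-- The function g and its outer part have the same Z-moment α, so the slab part has none. -/
theorem integral_slab_inner (s : MaxStructure η g) :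
    ∫ x, slab η (dir g) g x * inner ℝ (dir g) x ∂gam n = 0 := by
  rw [integral_slab_mul s.norm_dir s.mem s.outside (AllLp.inner _), ← inner_firstMoment s.mem,
    s.firstMoment_eq, inner_smul_right, real_inner_self_eq_norm_sq, s.norm_dir,
    integral_comp_inner s.norm_dir (F := fun z => outer η z * z)
      ((measurable_outer η).mul measurable_id), integral_outer_mul_id s.pos]
  ring

/-- The contribution of the slab to `𝔼[g H₃(Z)]`. -/
theorem abs_integral_slab_H_le (s : MaxStructure η g) :
    |∫ x, slab η (dir g) g x * H 3 (inner ℝ (dir g) x) ∂gam n| ≤ Amax η := by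
  have hZ := AllLp.inner (dir g)
  -- Multiples of Z can be added for free. The coefficient η²/2 is the midpoint of the range of z²
  -- in the slab, so |z² - η²/2| ≤ η²/2 there, and the resulting bound (η²/2)s₁ is A_max.
  have hP : AllLp fun x : E n => inner ℝ (dir g) x ^ 3 - η ^ 2 / 2 * inner ℝ (dir g) x :=
    (hZ.pow 3).sub (hZ.const_mul _)
  have e : ∫ x, slab η (dir g) g x * H 3 (inner ℝ (dir g) x) ∂gam n =
      ∫ x, slab η (dir g) g x *
        (inner ℝ (dir g) x ^ 3 - η ^ 2 / 2 * inner ℝ (dir g) x) ∂gam n := by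
    have h : ∀ x, slab η (dir g) g x * H 3 (inner ℝ (dir g) x) =
        slab η (dir g) g x * (inner ℝ (dir g) x ^ 3 - η ^ 2 / 2 * inner ℝ (dir g) x) +
        (η ^ 2 / 2 - 3) * (slab η (dir g) g x * inner ℝ (dir g) x) := by
      intro x; rw [H_three]; ring
    simp_rw [h]
    rw [integral_add (allLp_slab_mul η _ s.mem hP).integrable
      ((allLp_slab_mul η _ s.mem hZ).integrable.const_mul _), integral_const_mul,
      s.integral_slab_inner]
    ring
  rw [e]
  refine (abs_integral_slab_mul_le s.mem ((hZ.abs.const_mul (η ^ 2 / 2)).mul (AllLp.const 1))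
    fun x hx => ?_).trans ?_
  · have : inner ℝ (dir g) x ^ 3 - η ^ 2 / 2 * inner ℝ (dir g) x =
        (inner ℝ (dir g) x ^ 2 - η ^ 2 / 2) * inner ℝ (dir g) x := by ring
    rw [this, abs_mul, mul_one]
    refine mul_le_mul_of_nonneg_right ?_ (abs_nonneg _)
    have h2 := sq_abs (inner ℝ (dir g) x : ℝ)
    have h3 := abs_nonneg (inner ℝ (dir g) x : ℝ)
    rw [abs_le]
    constructor <;> nlinarith [s.pos]
  · rw [integral_slab_one_mul s.norm_dir (F := fun z => η ^ 2 / 2 * |z|) (by fun_prop)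
      (q := fun _ => 1) measurable_const (fun _ => rfl), integral_const_mul]
    have := s₁_eq s.pos
    rw [s₁] at this
    rw [this, Amax]
    simp
    apply le_of_eq; ring

theorem integral_mul_H (s : MaxStructure η g) : ∫ x, g x * H 3 (inner ℝ (dir g) x) ∂gam n =
    ∫ x, slab η (dir g) g x * H 3 (inner ℝ (dir g) x) ∂gam n + B η := by
  rw [integral_slab_mul s.norm_dir s.mem s.outside ((AllLp.inner _).H 3),
    integral_comp_inner s.norm_dir (F := fun z => outer η z * H 3 z)
      ((measurable_outer η).mul (measurable_H 3)), integral_outer_mul_H s.pos]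
  ring

theorem integral_signR_mul_H (s : MaxStructure η g) :
    ∫ x, signR (lamOf η) g x * H 3 (inner ℝ (dir g) x) ∂gam n =
      -∫ x, slab η (dir g) g x * H 3 (inner ℝ (dir g) x) ∂gam n + B η := by
  have hH := (AllLp.inner (dir g)).H 3
  have e : ∫ x, signR (lamOf η) g x * H 3 (inner ℝ (dir g) x) ∂gam n =
      ∫ x, (outer η (inner ℝ (dir g) x) * H 3 (inner ℝ (dir g) x) -
        slab η (dir g) g x * H 3 (inner ℝ (dir g) x)) ∂gam n := by
    refine integral_congr_ae ?_
    filter_upwards [s.signR_eq] with x hx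
    rw [hx]; ring
  rw [e, integral_sub (allLp_outer_mul η _ hH).integrable (allLp_slab_mul η _ s.mem hH).integrable,
    integral_comp_inner s.norm_dir (F := fun z => outer η z * H 3 z)
      ((measurable_outer η).mul (measurable_H 3)), integral_outer_mul_H s.pos]
  ring

/-- The two moments are B + A and B - A with A the slab contribution, so the product is B² - A² with
|A| ≤ A_max. -/
theorem kappaQ_le (s : MaxStructure η g) : kappaQ η ≤
    1 / 6 * (∫ x, g x * H 3 (inner ℝ (dir g) x) ∂gam n) *
      (∫ x, signR (lamOf η) g x * H 3 (inner ℝ (dir g) x) ∂gam n) := by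
  rw [s.integral_mul_H, s.integral_signR_mul_H, kappaQ]
  have h := s.abs_integral_slab_H_le
  generalize (∫ x, slab η (dir g) g x * H 3 (inner ℝ (dir g) x) ∂gam n) = A at *
  obtain ⟨h1, h2⟩ := abs_le.1 h
  nlinarith

theorem P3_eq (s : MaxStructure η g) :
    P3 g =ᵐ[gam n] proj (zonal (dir g)) g + proj (transverse (dir g)) g := by
  rw [P3, proj_eq _ s.memLp, proj_eq _ s.memLp, proj_eq _ s.memLp, projLp_chaos s.norm_dir]
  exact Lp.coeFn_add _ _

theorem transverse_eq (s : MaxStructure η g) :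
    proj (transverse (dir g)) g =ᵐ[gam n]
      proj (block (dir g) 1 2) g + proj (block (dir g) 2 1) g + proj (block (dir g) 0 3) g := by
  simp only [proj_eq _ s.memLp, projLp_transverse s.norm_dir]
  exact (Lp.coeFn_add _ _).trans ((Lp.coeFn_add _ _).add (ae_eq_refl _))

theorem memLp_signR (s : MaxStructure η g) : MemLp (signR (lamOf η) g) 2 (gam n) := by
  have h1 := (allLp_slab_mul η (dir g) s.mem (AllLp.const 1)).memLp_two
  have h2 := (allLp_outer_mul η (dir g) (AllLp.const 1)).memLp_two
  refine (memLp_congr_ae ?_).2 (h2.sub h1)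
  filter_upwards [s.signR_eq] with x hx
  rw [hx]; simp; ring

theorem finiteDimensional_transverse {u : E n} (hu : ‖u‖ = 1) :
    FiniteDimensional ℝ (transverse u) := by
  obtain ⟨h1, h2, h3, -⟩ := finiteDimensional_blocks hu
  unfold transverse; infer_instance

theorem integral_mul_projLp {g : E n → ℝ} (hg : MemLp g 2 (gam n))
    (K : Submodule ℝ (Lp ℝ 2 (gam n))) [FiniteDimensional ℝ K] :
    ∫ x, g x * projLp K (hg.toLp g) x ∂gam n = ‖projLp K (hg.toLp g)‖ ^ 2 := by
  rw [← inner_eq_integral hg.coeFn_toLp (ae_eq_refl _), ← real_inner_self_eq_norm_sq]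
  have := inner_sub_projLp (hg.toLp g) (projLp_mem K (hg.toLp g))
  rw [inner_sub_left] at this
  linarith

theorem integral_proj_sq {g : E n → ℝ} (hg : MemLp g 2 (gam n))
    (K : Submodule ℝ (Lp ℝ 2 (gam n))) :
    ∫ x, proj K g x ^ 2 ∂gam n = ‖projLp K (hg.toLp g)‖ ^ 2 := by
  rw [proj_eq K hg, ← real_inner_self_eq_norm_sq, inner_eq_integral (ae_eq_refl _) (ae_eq_refl _)]
  simp_rw [sq]

/-- Almost everywhere sign(R_λ g) = 2o - g with o the outer part; o depends on Z only and is
orthogonal to the transverse space. -/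
theorem integral_signR_mul_transverse (s : MaxStructure η g) :
    ∫ x, signR (lamOf η) g x * projLp (transverse (dir g)) (s.memLp.toLp g) x ∂gam n =
      -‖projLp (transverse (dir g)) (s.memLp.toLp g)‖ ^ 2 := by
  have := finiteDimensional_transverse s.norm_dir
  have hmem := projLp_mem (transverse (dir g)) (s.memLp.toLp g)
  have hk := integral_mul_projLp s.memLp (transverse (dir g))
  generalize projLp (transverse (dir g)) (s.memLp.toLp g) = T at *
  have hO : MemLp (fun x => 2 * outer η (inner ℝ (dir g) x)) 2 (gam n) := by
    simpa using ((allLp_outer_mul η (dir g) (AllLp.const 1)).const_mul 2).memLp_two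
  have h0 := integral_mul_transverse s.norm_dir (F := fun z => 2 * outer η z)
    ((measurable_outer η).const_mul 2) hO hmem
  have e : ∫ x, signR (lamOf η) g x * T x ∂gam n =
      ∫ x, (2 * outer η (inner ℝ (dir g) x) * T x - g x * T x) ∂gam n := by
    refine integral_congr_ae ?_
    filter_upwards [s.signR_eq, ae_eq_slab_add_outer s.norm_dir s.outside] with x h1 h2
    rw [h1, h2]; ring
  rw [e, integral_sub (integrable_mul_Lp hO T) (integrable_mul_Lp s.memLp T), h0, hk]
  ring

theorem pairing_eq (s : MaxStructure η g) :
    pairing (signR (lamOf η) g) (P3 g) =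
      1 / 6 * (∫ x, g x * H 3 (inner ℝ (dir g) x) ∂gam n) *
        (∫ x, signR (lamOf η) g x * H 3 (inner ℝ (dir g) x) ∂gam n) -
      ∫ x, proj (transverse (dir g)) g x ^ 2 ∂gam n := by
  rw [pairing, integral_proj_sq s.memLp]
  have e : ∫ x, signR (lamOf η) g x * P3 g x ∂gam n =
      ∫ x, (1 / 6 * (∫ x, g x * H 3 (inner ℝ (dir g) x) ∂gam n) *
        (signR (lamOf η) g x * H 3 (inner ℝ (dir g) x)) +
        signR (lamOf η) g x * projLp (transverse (dir g)) (s.memLp.toLp g) x) ∂gam n := by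
    refine integral_congr_ae ?_
    have h := s.P3_eq
    rw [proj_eq _ s.memLp, proj_eq _ s.memLp, projLp_zonal s.norm_dir] at h
    filter_upwards [h, coeFn_wickLp_self s.norm_dir, Lp.coeFn_smul
      (1 / 6 * ∫ x, g x * H 3 (inner ℝ (dir g) x) ∂gam n)
      (wickLp (dir g) (dir g) (dir g))] with x h1 h2 h3
    rw [h1, Pi.add_apply, h3, Pi.smul_apply, h2, smul_eq_mul]
    ring
  rw [e, integral_add, integral_const_mul, s.integral_signR_mul_transverse]
  · ring
  · exact (s.memLp_signR.integrable_mul (memLp_H_inner (dir g) 3)).const_mul _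
  · exact integrable_mul_Lp s.memLp_signR _

/-- The bound for the projection onto one block, in terms of a function `F` that can replace
`H_j` on the slab. -/
theorem norm_projLp_block_le (s : MaxStructure η g) {j k : ℕ} (hj : j ≤ 3) (hk : 1 ≤ k)
    (hk' : k ≤ 3) [FiniteDimensional ℝ (block (dir g) j k)] {F : ℝ → ℝ} (hF : Measurable F)
    (hF' : AllLp fun x => F (inner ℝ (dir g) x))
    (hrep : ∀ q ∈ perpSpan (dir g) k,
      ∫ x, slab η (dir g) g x * (H j (inner ℝ (dir g) x) * q x) ∂gam n =
      ∫ x, slab η (dir g) g x * (F (inner ℝ (dir g) x) * q x) ∂gam n) :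
    ‖projLp (block (dir g) j k) (s.memLp.toLp g)‖ ^ 2 ≤
      (∫ z in {z : ℝ | |z| < η}, |F z| ∂gaussianReal 0 1) ^ 2 / j.factorial := by
  have hu := s.norm_dir
  obtain ⟨q, hq, e⟩ := exists_of_mem_block (projLp_mem (block (dir g) j k) (s.memLp.toLp g))
  obtain ⟨q1, q2, q3⟩ := perpSpan_spec hq
  have hHj := (AllLp.inner (dir g)).H j
  have h1 := integral_mul_projLp s.memLp (block (dir g) j k)
  have h2 : ‖projLp (block (dir g) j k) (s.memLp.toLp g)‖ ^ 2 =
      j.factorial * ∫ x, q x * q x ∂gam n := by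
    rw [← real_inner_self_eq_norm_sq, inner_eq_integral e e]
    have : ∀ x, H j (inner ℝ (dir g) x) * q x * (H j (inner ℝ (dir g) x) * q x) =
      H j (inner ℝ (dir g) x) * H j (inner ℝ (dir g) x) * (q x * q x) := fun x => by ring
    simp_rw [this]
    rw [integral_mul_of_perp hu (F := fun z => H j z * H j z)
      ((measurable_H j).mul (measurable_H j)) (q := fun x => q x * q x) (q1.mul q1)
      (fun x => by rw [q3]), integral_H_mul_H hj hj, if_pos rfl]
  -- The squared norm of the projection is also its pairing with g. The outer part drops out because
  -- q has mean zero, so only the slab remains.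
  have h3 : ∫ x, g x * projLp (block (dir g) j k) (s.memLp.toLp g) x ∂gam n =
      ∫ x, slab η (dir g) g x * (F (inner ℝ (dir g) x) * q x) ∂gam n := by
    rw [← hrep q hq, integral_slab_mul hu s.mem s.outside (hHj.mul q2)]
    have : ∫ x, outer η (inner ℝ (dir g) x) * (H j (inner ℝ (dir g) x) * q x) ∂gam n = 0 := by
      simp_rw [← mul_assoc]
      rw [integral_mul_of_perp hu (F := fun z => outer η z * H j z)
        ((measurable_outer η).mul (measurable_H j)) q1 q3, perpSpan_integral hk hk' hq, mul_zero]
    rw [this, sub_zero]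
    refine integral_congr_ae ?_
    filter_upwards [e] with x hx
    rw [hx]
  have h4 := abs_integral_slab_mul_le (η := η) (u := dir g) s.mem (hF'.abs.mul q2.abs)
    (fun x _ => (abs_mul _ _).le)
  rw [integral_slab_one_mul hu (F := fun z => |F z|) (by fun_prop) (q := fun x => |q x|)
    (by fun_prop) (fun x => by rw [q3]), ← h3, h1, abs_of_nonneg (sq_nonneg _)] at h4
  -- Nonnegativity of the variance of |q|.
  have h5 : (∫ x, |q x| ∂gam n) ^ 2 ≤ ∫ x, q x * q x ∂gam n := by
    have h := variance_nonneg (fun x => |q x|) (gam n)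
    rw [variance_eq_sub q2.abs.memLp_two] at h
    simp only [Pi.pow_apply, sq_abs] at h
    simp_rw [sq] at h ⊢
    linarith
  have h6 : 0 ≤ ∫ z in {z : ℝ | |z| < η}, |F z| ∂gaussianReal 0 1 :=
    integral_nonneg fun z => abs_nonneg _
  have h7 : (0 : ℝ) < j.factorial := by positivity
  rw [le_div_iff₀ h7]
  generalize ‖projLp (block (dir g) j k) (s.memLp.toLp g)‖ ^ 2 = N at *
  generalize (∫ z in {z : ℝ | |z| < η}, |F z| ∂gaussianReal 0 1) = c at *
  generalize (∫ x, |q x| ∂gam n) = a at *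
  generalize (∫ x, q x * q x ∂gam n) = b at *
  -- From N = j!·b, N ≤ c·a and a² ≤ b follows N·j! ≤ c² after cancelling N, which requires b > 0.
  rcases (sq_nonneg a |>.trans h5).eq_or_lt with hb | hb
  · rw [h2, ← hb]; simp; positivity
  · have hN : 0 < N := by rw [h2]; positivity
    have h8 : N ^ 2 ≤ c ^ 2 * b := by
      calc N ^ 2 ≤ (c * a) ^ 2 := by gcongr
        _ = c ^ 2 * a ^ 2 := by ring
        _ ≤ c ^ 2 * b := by gcongr
    have h9 : N * (N * j.factorial) ≤ N * c ^ 2 := by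
      calc N * (N * j.factorial) = N ^ 2 * j.factorial := by ring
        _ ≤ c ^ 2 * b * j.factorial := by gcongr
        _ = N * c ^ 2 := by rw [h2]; ring
    exact le_of_mul_le_mul_left h9 hN

theorem integral_slab_perp (s : MaxStructure η g) {w : E n} (hw : inner ℝ (dir g) w = 0) :
    ∫ x, slab η (dir g) g x * inner ℝ w x ∂gam n = 0 := by
  rw [integral_slab_mul s.norm_dir s.mem s.outside (AllLp.inner _), ← inner_firstMoment s.mem,
    s.firstMoment_eq, inner_smul_right, real_inner_comm, hw,
    integral_mul_of_perp s.norm_dir (measurable_outer η) (q := fun x => inner ℝ w x)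
      (by fun_prop) (fun x => inner_perp hw x), integral_inner_eq_zero]
  ring

/-- The blocks with j = 1, 0, 2 give s₁², p² and t₂²/2. -/
theorem transverse_le (s : MaxStructure η g) :
    ∫ x, proj (transverse (dir g)) g x ^ 2 ∂gam n ≤ transverseBound η := by
  have hu := s.norm_dir
  obtain ⟨f1, f2, f3, -⟩ := finiteDimensional_blocks hu
  have f4 := finiteDimensional_transverse hu
  have hZ := AllLp.inner (dir g)
  have b12 := s.norm_projLp_block_le (j := 1) (k := 2) (F := fun z => z) (by norm_num)
    (by norm_num) (by norm_num) measurable_id hZ (fun q _ => by simp only [H_one])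
  have b03 := s.norm_projLp_block_le (j := 0) (k := 3) (F := fun _ => 1) (by norm_num)
    (by norm_num) (by norm_num) measurable_const (AllLp.const 1) (fun q _ => by simp only [H_zero])
  -- The slab part is orthogonal to linear forms in Y, so the -1 in H₂ can be dropped.
  have b21 := s.norm_projLp_block_le (j := 2) (k := 1) (F := fun z => z ^ 2) (by norm_num)
    (by norm_num) (by norm_num) (by fun_prop) (hZ.pow 2) (fun q hq => by
      obtain ⟨w, hw, rfl⟩ := perpSpan_one hq
      have h : ∀ x, slab η (dir g) g x * (H 2 (inner ℝ (dir g) x) * inner ℝ w x) =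
          slab η (dir g) g x * (inner ℝ (dir g) x ^ 2 * inner ℝ w x) -
            slab η (dir g) g x * inner ℝ w x := fun x => by rw [H_two]; ring
      simp_rw [h]
      rw [integral_sub (allLp_slab_mul η _ s.mem ((hZ.pow 2).mul (AllLp.inner w))).integrable
        (allLp_slab_mul η _ s.mem (AllLp.inner w)).integrable, s.integral_slab_perp hw, sub_zero])
  have e : ‖projLp (transverse (dir g)) (s.memLp.toLp g)‖ ^ 2 =
      ‖projLp (block (dir g) 1 2) (s.memLp.toLp g)‖ ^ 2 +
      ‖projLp (block (dir g) 2 1) (s.memLp.toLp g)‖ ^ 2 +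
      ‖projLp (block (dir g) 0 3) (s.memLp.toLp g)‖ ^ 2 := by
    -- Pythagoras: ‖Pg‖² = ⟨g, Pg⟩ is additive over the blocks.
    have key : ∀ (K : Submodule ℝ (Lp ℝ 2 (gam n))) [FiniteDimensional ℝ K],
        ‖projLp K (s.memLp.toLp g)‖ ^ 2 = inner ℝ (s.memLp.toLp g) (projLp K (s.memLp.toLp g)) := by
      intro K _
      rw [← integral_mul_projLp s.memLp K, inner_eq_integral s.memLp.coeFn_toLp (ae_eq_refl _)]
    rw [key, key, key, key, ← inner_add_right, ← inner_add_right, ← projLp_transverse hu]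
  rw [integral_proj_sq s.memLp, e, transverseBound]
  have hp : p η = ∫ z in {z : ℝ | |z| < η}, |(1 : ℝ)| ∂gaussianReal 0 1 := by simp [p]
  have ht : t₂ η = ∫ z in {z : ℝ | |z| < η}, |z ^ 2| ∂gaussianReal 0 1 := by simp [t₂]
  rw [← hp] at b03
  rw [← ht] at b21
  change _ ≤ s₁ η ^ 2 / _ at b12
  norm_num [Nat.factorial] at b03 b21 b12
  linarith

end MaxStructure

theorem maxStructure_of_isMaximizer {η : ℝ} (h0 : 0 < η) (h1 : η < 1 / 2) (hn : 1 ≤ n)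
    {g : E n → ℝ} (hpm : ∀ x, g x = 1 ∨ g x = -1) (hg : IsMaximizer (lamOf η) g) :
    MaxStructure η g :=
  ⟨h0, hg.1, hpm, (maximizer_structure h0 h1 hn hg).1, (maximizer_structure h0 h1 hn hg).2⟩

/-! ### The unique maximum of the Davie-Reeds quantity -/

/-- The function whose sign is opposite to that of the derivative of `davieReeds`. -/
def criticalFun (η : ℝ) : ℝ := 4 * gd η ^ 2 + 4 * Phi η - 3

/-- The denominator of `davieReeds`. -/
def denom (η : ℝ) : ℝ := 4 * gd η ^ 2 + 2 * (η * gd η) * (4 * Phi η - 3)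

theorem davieReeds_eq {η : ℝ} (hη : η ≠ 0) :
    davieReeds η = (1 - 2 * (η * gd η)) / denom η := by
  have h := alphaOf_eq hη
  rw [alphaOf] at h
  rw [davieReeds, h, lamOf_eq, Phi_neg, denom]
  congr 1 <;> ring

theorem gd_zero_lt : gd 0 < 0.4 := by
  rw [gd_zero, inv_lt_comm₀ (by positivity) (by norm_num), Real.lt_sqrt (by norm_num)]
  have := Real.pi_gt_d4
  norm_num at this ⊢; linarith

theorem gd_lt (η : ℝ) : gd η < 0.4 := by
  refine lt_of_le_of_lt ?_ gd_zero_lt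
  unfold gd
  refine div_le_div_of_nonneg_right (Real.exp_le_exp.2 ?_) (Real.sqrt_nonneg _)
  nlinarith [sq_nonneg η]

/-- As in `two_mul_Phi_neg_lt`, but only η < 2γ(η)(1 + 2η²) is needed, which holds up to η = 1. -/
theorem denom_pos {η : ℝ} (h0 : 0 < η) (h1 : η < 1) : 0 < denom η := by
  have h2 := mul_gd_le_Phi_sub h0.le
  have h3 := gd_ge η
  have h4 := gd_zero_gt
  have hg := gd_pos η
  have h6 : 0.398 * (1 - η ^ 2 / 2) ≤ gd η := le_trans (by gcongr; nlinarith) h3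
  have h7 : η < 2 * (0.398 * (1 - η ^ 2 / 2) * (1 + 2 * η ^ 2)) := by
    have h8 : 0 ≤ η ^ 2 * (1 - η ^ 2) := by
      apply mul_nonneg (sq_nonneg _); nlinarith
    nlinarith [sq_nonneg (η - 0.6)]
  have h8 : 0.398 * (1 - η ^ 2 / 2) * (1 + 2 * η ^ 2) ≤ gd η * (1 + 2 * η ^ 2) := by gcongr
  have h9 : η * (4 * (η * gd η) - 1) ≤ η * (4 * Phi η - 3) :=
    mul_le_mul_of_nonneg_left (by linarith) h0.le
  have : denom η = 2 * gd η * (2 * gd η + η * (4 * Phi η - 3)) := by rw [denom]; ring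
  rw [this]
  refine mul_pos (by positivity) ?_
  nlinarith

theorem hasDerivAt_criticalFun (η : ℝ) :
    HasDerivAt criticalFun (4 * gd η * (1 - 2 * η * gd η)) η :=
  (((((hasDerivAt_gd η).pow 2).const_mul 4).add ((hasDerivAt_Phi η).const_mul 4)).sub_const
    3).congr_deriv (by simp; ring)

theorem hasDerivAt_denom (η : ℝ) :
    HasDerivAt denom (2 * (1 - η ^ 2) * gd η * (4 * Phi η - 3)) η :=
  ((((hasDerivAt_gd η).pow 2).const_mul 4).add (((hasDerivAt_id_mul_gd η).const_mul 2).mul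
    (((hasDerivAt_Phi η).const_mul 4).sub_const 3))).congr_deriv (by simp; ring)

theorem criticalFun_strictMonoOn : StrictMonoOn criticalFun (Set.Icc 0 1) := by
  refine strictMonoOn_of_deriv_pos (convex_Icc _ _)
    (fun x _ => (hasDerivAt_criticalFun x).continuousAt.continuousWithinAt) ?_
  intro x hx
  rw [interior_Icc] at hx
  rw [(hasDerivAt_criticalFun x).deriv]
  have := gd_pos x
  have := gd_lt x
  exact mul_pos (by positivity) (by nlinarith [hx.1, hx.2])

/-- The closed form of `davieReeds`. -/
def davieReeds' (η : ℝ) : ℝ := (1 - 2 * (η * gd η)) / denom η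

/-- Numerator and denominator both have derivatives with factor 2(1 - η²)γ(η). In the remaining
factor the terms 2ηγ(4Φ - 3) cancel and leave `criticalFun`. -/
theorem hasDerivAt_davieReeds' {η : ℝ} (h0 : 0 < η) (h1 : η < 1) :
    HasDerivAt davieReeds' (-(2 * (1 - η ^ 2) * gd η / denom η ^ 2) * criticalFun η) η := by
  have hd := (denom_pos h0 h1).ne'
  refine ((((hasDerivAt_id_mul_gd η).const_mul 2).const_sub 1).div (hasDerivAt_denom η)
    hd).congr_deriv ?_
  rw [show -(2 * (1 - η ^ 2) * gd η / denom η ^ 2) * criticalFun η =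
    -(2 * (1 - η ^ 2) * gd η * criticalFun η) / denom η ^ 2 by ring]
  congr 1
  simp only [denom, criticalFun]; ring

theorem davieReeds_lt {r η : ℝ} (hr0 : 0 < r) (hr1 : r < 1) (hr : criticalFun r = 0)
    (h0 : 0 < η) (h1 : η < 1) (hne : η ≠ r) : davieReeds η < davieReeds r := by
  rw [davieReeds_eq h0.ne', davieReeds_eq hr0.ne']
  change davieReeds' η < davieReeds' r
  have hcoef : ∀ x, 0 < x → x < 1 → 0 < 2 * (1 - x ^ 2) * gd x / denom x ^ 2 := by
    intro x hx0 hx1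
    have := gd_pos x
    have := denom_pos hx0 hx1
    have : 0 < 1 - x ^ 2 := by nlinarith
    positivity
  have hrm : r ∈ Set.Icc (0 : ℝ) 1 := ⟨hr0.le, hr1.le⟩
  rcases lt_or_gt_of_ne hne with h | h
  · have : StrictMonoOn davieReeds' (Set.Icc η r) := by
      refine strictMonoOn_of_deriv_pos (convex_Icc _ _) (fun x hx =>
        (hasDerivAt_davieReeds' (h0.trans_le hx.1)
          (hx.2.trans_lt hr1)).continuousAt.continuousWithinAt) fun x hx => ?_
      rw [interior_Icc] at hx
      have hx0 := h0.trans hx.1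
      have hx1 := hx.2.trans hr1
      rw [(hasDerivAt_davieReeds' hx0 hx1).deriv]
      have hc := criticalFun_strictMonoOn ⟨hx0.le, hx1.le⟩ hrm hx.2
      rw [hr] at hc
      have := hcoef x hx0 hx1
      nlinarith
    exact this ⟨le_rfl, h.le⟩ ⟨h.le, le_rfl⟩ h
  · have : StrictAntiOn davieReeds' (Set.Icc r η) := by
      refine strictAntiOn_of_deriv_neg (convex_Icc _ _) (fun x hx =>
        (hasDerivAt_davieReeds' (hr0.trans_le hx.1)
          (hx.2.trans_lt h1)).continuousAt.continuousWithinAt) fun x hx => ?_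
      rw [interior_Icc] at hx
      have hx0 := hr0.trans hx.1
      have hx1 := hx.2.trans h1
      rw [(hasDerivAt_davieReeds' hx0 hx1).deriv]
      have hc := criticalFun_strictMonoOn hrm ⟨hx0.le, hx1.le⟩ hx.1
      rw [hr] at hc
      have := hcoef x hx0 hx1
      nlinarith
    exact this ⟨le_rfl, h.le⟩ ⟨h.le, le_rfl⟩ h

theorem isReedsPoint_iff {r : ℝ} (hr0 : 0 < r) (hr1 : r < 1) (hr : criticalFun r = 0) (η : ℝ) :
    IsReedsPoint η ↔ η = r := by
  constructor
  · rintro ⟨⟨h0, h1⟩, hmax⟩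
    by_contra hne
    have := davieReeds_lt hr0 hr1 hr h0 h1 hne
    have h2 : davieReeds r ≤ davieReeds η := hmax ⟨hr0, hr1⟩
    linarith
  · rintro rfl
    refine ⟨⟨hr0, hr1⟩, fun x hx => ?_⟩
    rcases eq_or_ne x η with rfl | hne
    · exact le_refl (davieReeds x)
    · exact (davieReeds_lt hr0 hr1 hr hx.1 hx.2 hne).le

/-! ### Numerical bounds -/

theorem gd_zero_bounds : 0.398942280401432 ≤ gd 0 ∧ gd 0 ≤ 0.398942280401433 := by
  have h1 := Real.pi_gt_d20
  have h2 := Real.pi_lt_d20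
  have h3 : gd 0 ^ 2 * (2 * Real.pi) = 1 := by
    rw [gd_zero, inv_pow, Real.sq_sqrt (by positivity), inv_mul_cancel₀ (by positivity)]
  have hg := gd_pos 0
  constructor
  · by_contra! h
    have h4 : gd 0 ^ 2 * (2 * Real.pi) ≤
        0.398942280401432 ^ 2 * (2 * 3.14159265358979323847) := by gcongr
    norm_num at h4 h3
    linarith
  · by_contra! h
    have h4 : 0.398942280401433 ^ 2 * (2 * 3.14159265358979323846) ≤
        gd 0 ^ 2 * (2 * Real.pi) := by gcongr
    norm_num at h4 h3
    linarith

/-- A Taylor polynomial of `exp (-z ^ 2 / 2)`. -/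
def expPoly (z : ℝ) : ℝ :=
  1 - z ^ 2 / 2 + z ^ 4 / 8 - z ^ 6 / 48 + z ^ 8 / 384 - z ^ 10 / 3840 + z ^ 12 / 46080

/-- The primitive of `expPoly` vanishing at zero. -/
def erfPoly (z : ℝ) : ℝ :=
  z - z ^ 3 / 6 + z ^ 5 / 40 - z ^ 7 / 336 + z ^ 9 / 3456 - z ^ 11 / 42240 + z ^ 13 / 599040

theorem hasDerivAt_erfPoly (z : ℝ) : HasDerivAt erfPoly (expPoly z) z := by
  have h := fun k : ℕ => hasDerivAt_pow (𝕜 := ℝ) k z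
  refine (((((((hasDerivAt_id z).sub ((h 3).div_const 6)).add ((h 5).div_const 40)).sub
    ((h 7).div_const 336)).add ((h 9).div_const 3456)).sub ((h 11).div_const 42240)).add
    ((h 13).div_const 599040)).congr_deriv ?_
  rw [expPoly]
  norm_num
  ring

theorem abs_gd_sub_le {z : ℝ} (h0 : 0 ≤ z) (h1 : z ≤ 0.26) :
    |gd z - gd 0 * expPoly z| ≤ 1e-14 := by
  have e : gd z = gd 0 * Real.exp (-z ^ 2 / 2) := by rw [gd_zero, gd]; field_simp
  -- The bound 0.0338 is 0.26²/2.
  have hy : |(-z ^ 2 / 2)| ≤ 0.0338 := by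
    rw [neg_div, abs_neg, abs_of_nonneg (by positivity)]
    nlinarith
  have hb := Real.exp_bound (x := -z ^ 2 / 2) (hy.trans (by norm_num)) (n := 7) (by norm_num)
  have hs : ∑ m ∈ Finset.range 7, (-z ^ 2 / 2) ^ m / (m.factorial : ℝ) = expPoly z := by
    simp only [Finset.sum_range_succ, Finset.sum_range_zero, Nat.factorial, expPoly]
    norm_num
    ring
  rw [hs] at hb
  have hle : |(-z ^ 2 / 2)| ^ 7 * (((Nat.succ 7 : ℕ) : ℝ) / ((Nat.factorial 7 : ℕ) * (7 : ℕ))) ≤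
      0.0338 ^ 7 * (((Nat.succ 7 : ℕ) : ℝ) / ((Nat.factorial 7 : ℕ) * (7 : ℕ))) := by gcongr
  have h2 := hb.trans hle
  have h3 : (0.0338 : ℝ) ^ 7 * (((Nat.succ 7 : ℕ) : ℝ) / ((Nat.factorial 7 : ℕ) * (7 : ℕ))) ≤
      2e-14 := by norm_num [Nat.factorial]
  rw [e, ← mul_sub, abs_mul, abs_of_pos (gd_pos 0)]
  calc gd 0 * |Real.exp (-z ^ 2 / 2) - expPoly z| ≤ 0.4 * 2e-14 := by
        gcongr
        · exact gd_zero_lt.le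
        · exact h2.trans h3
    _ ≤ 1e-14 := by norm_num

/-- Integrate `abs_gd_sub_le` over an interval of length less than 1. -/
theorem abs_Phi_sub_le {x : ℝ} (h0 : 0 ≤ x) (h1 : x ≤ 0.26) :
    |Phi x - 1 / 2 - gd 0 * erfPoly x| ≤ 1e-14 := by
  have hc : Continuous expPoly := by unfold expPoly; fun_prop
  have h2 : ∫ z in (0 : ℝ)..x, gd 0 * expPoly z = gd 0 * erfPoly x := by
    rw [intervalIntegral.integral_const_mul, intervalIntegral.integral_eq_sub_of_hasDerivAt
      (fun z _ => hasDerivAt_erfPoly z) (hc.intervalIntegrable _ _)]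
    simp [erfPoly]
  rw [← Phi_zero, Phi_sub_Phi, ← h2, ← intervalIntegral.integral_sub
    (continuous_gd.intervalIntegrable _ _) ((hc.const_mul _).intervalIntegrable _ _)]
  have h3 := intervalIntegral.norm_integral_le_of_norm_le_const (a := 0) (b := x) (C := 1e-14)
    (f := fun z => gd z - gd 0 * expPoly z) (fun z hz => by
      rw [Set.uIoc_of_le h0] at hz
      exact abs_gd_sub_le hz.1.le (hz.2.trans h1))
  rw [Real.norm_eq_abs, sub_zero, abs_of_nonneg h0] at h3
  exact h3.trans (by nlinarith)

theorem gd_le_at_left : gd 0.255730213165 ≤ 0.38610825164156 := by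
  obtain ⟨h1, h2⟩ := gd_zero_bounds
  have h := (abs_le.1 (abs_gd_sub_le (z := 0.255730213165) (by norm_num) (by norm_num))).2
  have he : expPoly 0.255730213165 ≤ 0.96782986063303 := by norm_num [expPoly]
  have : gd 0 * expPoly 0.255730213165 ≤ 0.398942280401433 * 0.96782986063303 :=
    mul_le_mul h2 he (by norm_num [expPoly]) (by norm_num)
  linarith

theorem le_gd_at_right : 0.38610825164130 ≤ gd 0.255730213167 := by
  obtain ⟨h1, h2⟩ := gd_zero_bounds
  have h := (abs_le.1 (abs_gd_sub_le (z := 0.255730213167) (by norm_num) (by norm_num))).1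
  have he : 0.96782986063249 ≤ expPoly 0.255730213167 := by norm_num [expPoly]
  have : 0.398942280401432 * 0.96782986063249 ≤ gd 0 * expPoly 0.255730213167 :=
    mul_le_mul h1 he (by norm_num) (gd_pos 0).le
  linarith

theorem Phi_le_at_left : Phi 0.255730213165 ≤ 0.600920418013965 := by
  obtain ⟨h1, h2⟩ := gd_zero_bounds
  have h := (abs_le.1 (abs_Phi_sub_le (x := 0.255730213165) (by norm_num) (by norm_num))).2
  have he : erfPoly 0.255730213165 ≤ 0.25296997328135 := by norm_num [erfPoly]
  have : gd 0 * erfPoly 0.255730213165 ≤ 0.398942280401433 * 0.25296997328135 :=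
    mul_le_mul h2 he (by norm_num [erfPoly]) (by norm_num)
  linarith

theorem le_Phi_at_right : 0.60092041801469 ≤ Phi 0.255730213167 := by
  obtain ⟨h1, h2⟩ := gd_zero_bounds
  have h := (abs_le.1 (abs_Phi_sub_le (x := 0.255730213167) (by norm_num) (by norm_num))).1
  have he : 0.25296997328326 ≤ erfPoly 0.255730213167 := by norm_num [erfPoly]
  have : 0.398942280401432 * 0.25296997328326 ≤ gd 0 * erfPoly 0.255730213167 :=
    mul_le_mul h1 he (by norm_num) (gd_pos 0).le
  linarith

theorem exists_criticalFun_eq_zero :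
    ∃ r : ℝ, 0.255730213165 ≤ r ∧ r ≤ 0.255730213167 ∧ criticalFun r = 0 := by
  have ha : criticalFun 0.255730213165 ≤ 0 := by
    have h1 := gd_le_at_left
    have h2 := Phi_le_at_left
    have h3 := gd_pos 0.255730213165
    have h4 : gd 0.255730213165 ^ 2 ≤ 0.38610825164156 ^ 2 := by gcongr
    rw [criticalFun]
    norm_num at h4 h2 ⊢
    linarith
  have hb : 0 ≤ criticalFun 0.255730213167 := by
    have h1 := le_gd_at_right
    have h2 := le_Phi_at_right
    have h4 : 0.38610825164130 ^ 2 ≤ gd 0.255730213167 ^ 2 := by gcongr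
    rw [criticalFun]
    norm_num at h4 h2 ⊢
    linarith
  have hc : ContinuousOn criticalFun (Set.Icc 0.255730213165 0.255730213167) :=
    fun x _ => (hasDerivAt_criticalFun x).continuousAt.continuousWithinAt
  obtain ⟨r, hr, h0⟩ := intermediate_value_Icc (by norm_num) hc ⟨ha, hb⟩
  exact ⟨r, hr.1, hr.2, h0⟩

theorem gd_bounds {r : ℝ} (h1 : 0.255730213165 ≤ r) (h2 : r ≤ 0.255730213167) :
    0.38610825164130 ≤ gd r ∧ gd r ≤ 0.38610825164156 := by
  have h0 : (0 : ℝ) ≤ 0.255730213165 := by norm_num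
  exact ⟨le_gd_at_right.trans (gd_antitoneOn (h0.trans h1) (h0.trans (h1.trans h2)) h2),
    (gd_antitoneOn h0 (h0.trans h1) h1).trans gd_le_at_left⟩

theorem lamOf_bounds {r : ℝ} (h1 : 0.255730213165 ≤ r) (h2 : r ≤ 0.255730213167) :
    |lamOf r - 0.197479091| ≤ 1e-11 := by
  obtain ⟨h3, h4⟩ := gd_bounds h1 h2
  rw [lamOf_eq, abs_le]
  have h5 : r * gd r ≤ 0.255730213167 * 0.38610825164156 := by gcongr
  have h6 : 0.255730213165 * 0.38610825164130 ≤ r * gd r := by gcongr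
  norm_num at h5 h6 ⊢
  constructor <;> linarith

theorem kappaQ_bounds {r : ℝ} (h1 : 0.255730213165 ≤ r) (h2 : r ≤ 0.255730213167) :
    0.0868120048 + 4.5e-11 ≤ kappaQ r ∧ kappaQ r ≤ 0.0868120048 + 5.5e-11 := by
  obtain ⟨h3, h4⟩ := gd_bounds h1 h2
  obtain ⟨h5, h6⟩ := gd_zero_bounds
  have hr : 0 ≤ r := le_trans (by norm_num) h1
  have hg := gd_pos r
  have q1 : r ^ 2 ≤ 0.255730213167 ^ 2 := by gcongr
  have q2 : 0.255730213165 ^ 2 ≤ r ^ 2 := by gcongr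
  have q3 : 0 ≤ 1 - r ^ 2 := by norm_num at q1; linarith
  have b1 : (1 - r ^ 2) * gd r ≤ (1 - 0.255730213165 ^ 2) * 0.38610825164156 := by gcongr
  have b2 : (1 - 0.255730213167 ^ 2) * 0.38610825164130 ≤ (1 - r ^ 2) * gd r := by gcongr
  have b0 : 0 ≤ (1 - r ^ 2) * gd r := by positivity
  have b3 : ((1 - r ^ 2) * gd r) ^ 2 ≤ ((1 - 0.255730213165 ^ 2) * 0.38610825164156) ^ 2 := by
    gcongr
  have b4 : ((1 - 0.255730213167 ^ 2) * 0.38610825164130) ^ 2 ≤ ((1 - r ^ 2) * gd r) ^ 2 :=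
    pow_le_pow_left₀ (by norm_num) b2 2
  have d1 : gd 0 - gd r ≤ 0.398942280401433 - 0.38610825164130 := by linarith
  have d2 : 0.398942280401432 - 0.38610825164156 ≤ gd 0 - gd r := by linarith
  have d0 : 0 ≤ gd 0 - gd r := le_trans (by norm_num) d2
  have a1 : r ^ 2 * (gd 0 - gd r) ≤
      0.255730213167 ^ 2 * (0.398942280401433 - 0.38610825164130) := by gcongr
  have a2 : 0.255730213165 ^ 2 * (0.398942280401432 - 0.38610825164156) ≤
      r ^ 2 * (gd 0 - gd r) := mul_le_mul q2 d2 (by norm_num) (by positivity)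
  have a3 : (r ^ 2 * (gd 0 - gd r)) ^ 2 ≤
      (0.255730213167 ^ 2 * (0.398942280401433 - 0.38610825164130)) ^ 2 := by gcongr
  have a4 : (0.255730213165 ^ 2 * (0.398942280401432 - 0.38610825164156)) ^ 2 ≤
      (r ^ 2 * (gd 0 - gd r)) ^ 2 := pow_le_pow_left₀ (by norm_num) a2 2
  have e : kappaQ r = (4 * ((1 - r ^ 2) * gd r) ^ 2 - (r ^ 2 * (gd 0 - gd r)) ^ 2) / 6 := by
    rw [kappaQ, B_eq, Amax]; ring
  rw [e]
  generalize ((1 - r ^ 2) * gd r) ^ 2 = b at *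
  generalize (r ^ 2 * (gd 0 - gd r)) ^ 2 = a at *
  norm_num at b3 b4 a3 a4 ⊢
  constructor <;> linarith

theorem transverseBound_bounds {r : ℝ} (h1 : 0.255730213165 ≤ r) (h2 : r ≤ 0.255730213167)
    (hr : criticalFun r = 0) :
    0.0414080847 - 3e-11 ≤ transverseBound r ∧ transverseBound r ≤ 0.0414080847 - 2e-11 := by
  obtain ⟨h3, h4⟩ := gd_bounds h1 h2
  obtain ⟨h5, h6⟩ := gd_zero_bounds
  have hr0 : 0 < r := lt_of_lt_of_le (by norm_num) h1
  -- The critical equation eliminates Φ, so all quantities depend only on r, γ(r) and γ(0).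
  have hp : p r = 1 / 2 - 2 * gd r ^ 2 := by
    rw [criticalFun] at hr
    rw [p_eq hr0]; linarith
  have g1 : gd r ^ 2 ≤ 0.38610825164156 ^ 2 := by gcongr
  have g2 : 0.38610825164130 ^ 2 ≤ gd r ^ 2 := by gcongr
  have m1 : r * gd r ≤ 0.255730213167 * 0.38610825164156 := by gcongr
  have m2 : 0.255730213165 * 0.38610825164130 ≤ r * gd r := by gcongr
  have p1 : p r ≤ 1 / 2 - 2 * 0.38610825164130 ^ 2 := by rw [hp]; linarith
  have p2 : 1 / 2 - 2 * 0.38610825164156 ^ 2 ≤ p r := by rw [hp]; linarith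
  have s1 : s₁ r ≤ 2 * (0.398942280401433 - 0.38610825164130) := by rw [s₁_eq hr0]; linarith
  have s2 : 2 * (0.398942280401432 - 0.38610825164156) ≤ s₁ r := by rw [s₁_eq hr0]; linarith
  have t1 : t₂ r ≤ 1 / 2 - 2 * 0.38610825164130 ^ 2 -
      2 * (0.255730213165 * 0.38610825164130) := by rw [t₂_eq hr0]; linarith
  have t2 : 1 / 2 - 2 * 0.38610825164156 ^ 2 -
      2 * (0.255730213167 * 0.38610825164156) ≤ t₂ r := by rw [t₂_eq hr0]; linarith
  have p3 := pow_le_pow_left₀ p_nonneg p1 2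
  have p4 := pow_le_pow_left₀ (by norm_num) p2 2
  have s3 := pow_le_pow_left₀ s₁_nonneg s1 2
  have s4 := pow_le_pow_left₀ (by norm_num) s2 2
  have t3 := pow_le_pow_left₀ t₂_nonneg t1 2
  have t4 := pow_le_pow_left₀ (by norm_num) t2 2
  rw [transverseBound]
  generalize p r ^ 2 = x at *
  generalize s₁ r ^ 2 = y at *
  generalize t₂ r ^ 2 = z at *
  norm_num at p3 p4 s3 s4 t3 t4 ⊢
  constructor <;> linarith

end

end ReedsOperator

open ReedsOperator
theorem mainTheorem3 :
    -- The pairing bound, for every `η < 1/2`, with `lam = √(2/π) η e^{-η²/2}`.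
    (∀ η : ℝ, 0 < η → η < 1 / 2 →
      (alphaOf η = 2 * gd η ∧
        B η = -2 * (1 - η ^ 2) * gd η ∧
        p η = 2 * Phi η - 1 ∧
        s₁ η = 2 * (gd 0 - gd η) ∧
        t₂ η = p η - 2 * η * gd η) ∧
      ∀ n : ℕ, 1 ≤ n → ∀ g : E n → ℝ, (∀ x, g x = 1 ∨ g x = -1) → IsMaximizer (lamOf η) g →
        (‖firstMoment g‖ = alphaOf η ∧
          ∫ x, P1 g x ^ 2 ∂gam n = alphaOf η ^ 2 ∧
          (∀ x, P1 g x = alphaOf η * inner ℝ (dir g) x) ∧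
          ∀ᵐ x ∂gam n, signR (lamOf η) g x = 1 ∨ signR (lamOf η) g x = -1) ∧
        (P3 g =ᵐ[gam n] proj (zonal (dir g)) g + proj (transverse (dir g)) g ∧
          proj (transverse (dir g)) g =ᵐ[gam n]
            proj (block (dir g) 1 2) g + proj (block (dir g) 2 1) g + proj (block (dir g) 0 3) g ∧
          pairing (signR (lamOf η) g) (P3 g) =
            1 / 6 * (∫ x, g x * H 3 (inner ℝ (dir g) x) ∂gam n) *
                (∫ x, signR (lamOf η) g x * H 3 (inner ℝ (dir g) x) ∂gam n) -
              ∫ x, proj (transverse (dir g)) g x ^ 2 ∂gam n ∧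
          kappaQ η ≤
            1 / 6 * (∫ x, g x * H 3 (inner ℝ (dir g) x) ∂gam n) *
                (∫ x, signR (lamOf η) g x * H 3 (inner ℝ (dir g) x) ∂gam n)) ∧
        ∫ x, proj (transverse (dir g)) g x ^ 2 ∂gam n ≤ transverseBound η ∧
        kappaQ η - transverseBound η ≤ pairing (signR (lamOf η) g) (P3 g)) ∧
    -- The numerical bound at the Reeds point.
    (∃! η : ℝ, IsReedsPoint η) ∧
    ∀ η : ℝ, IsReedsPoint η →
      η < 1 / 2 ∧
      |lamOf η - 0.197479091| ≤ 1e-11 ∧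
      |kappaQ η - transverseBound η - 0.0454039202| ≤ 1e-10 ∧
      0.0868120048 ≤ kappaQ η ∧
      transverseBound η ≤ 0.0414080847 ∧
      ∀ n : ℕ, 1 ≤ n → ∀ g : E n → ℝ, (∀ x, g x = 1 ∨ g x = -1) → IsMaximizer (lamOf η) g →
        kappaQ η - transverseBound η ≤ pairing (signR (lamOf η) g) (P3 g) ∧
        0.0868120048 - 0.0414080847 ≤ pairing (signR (lamOf η) g) (P3 g) := by
  have pairing_ge : ∀ η : ℝ, 0 < η → η < 1 / 2 → ∀ n : ℕ, 1 ≤ n → ∀ g : E n → ℝ,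
      (∀ x, g x = 1 ∨ g x = -1) → IsMaximizer (lamOf η) g →
      kappaQ η - transverseBound η ≤ pairing (signR (lamOf η) g) (P3 g) := by
    intro η h0 h1 n hn g hpm hg
    have s := maxStructure_of_isMaximizer h0 h1 hn hpm hg
    rw [s.pairing_eq]
    exact sub_le_sub s.kappaQ_le s.transverse_le
  obtain ⟨r, ha, hb, hr⟩ := exists_criticalFun_eq_zero
  have hr0 : 0 < r := lt_of_lt_of_le (by norm_num) ha
  have hr1 : r < 1 / 2 := lt_of_le_of_lt hb (by norm_num)
  have hiff := isReedsPoint_iff hr0 (hr1.trans (by norm_num)) hr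
  refine ⟨fun η h0 h1 => ⟨⟨alphaOf_eq h0.ne', B_eq η, p_eq h0, s₁_eq h0, t₂_eq h0⟩,
    fun n hn g hpm hg => ?_⟩, ⟨r, (hiff r).2 rfl, fun η hη => (hiff η).1 hη⟩, fun η hη => ?_⟩
  · have s := maxStructure_of_isMaximizer h0 h1 hn hpm hg
    exact ⟨⟨s.norm_eq, s.integral_P1_sq, s.P1_eq', s.signR_pm⟩,
      ⟨s.P3_eq, s.transverse_eq, s.pairing_eq, s.kappaQ_le⟩, s.transverse_le,
      pairing_ge η h0 h1 n hn g hpm hg⟩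
  · obtain rfl := (hiff η).1 hη
    obtain ⟨k1, k2⟩ := kappaQ_bounds ha hb
    obtain ⟨t1, t2⟩ := transverseBound_bounds ha hb hr
    refine ⟨hr1, lamOf_bounds ha hb, ?_, ?_, ?_, fun n hn g hpm hg => ?_⟩
    -- The rounded constants differ by 0.0454039201; the enclosures put the true difference between
    -- 6.5·10⁻¹¹ and 8.5·10⁻¹¹ above that.
    · rw [abs_le]
      constructor <;> linarith
    · linarith
    · linarith
    · have := pairing_ge η hr0 hr1 n hn g hpm hg
      exact ⟨this, by linarith⟩
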